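/- **Setting.** Let $N,d\ge 1$ and let $G$ be a loopless multigraph with vertex set $\{1,\dots,N\}$ and finitely many edges; let $\Gamma_{ij}$ be the number of edges joining $i$ and $j$. Put $\omega=e^{2\pi \mathrm i/d}$, $X=\sum_{j\in\mathbb Z/d}|j+1\rangle\langle j|$, $Z=\sum_{j\in\mathbb Z/d}\omega^{j}|j\rangle\langle j|$. A graph state of $G$ is a unit vector $\psi\in(\mathbb C^d)^{\otimes N}$ with $g_j\psi=\psi$ for all $j$, where $g_j=X_j\prod_{l}Z_l^{\Gamma_{jl}}$. It is genuinely multipartite entangled (GME) if it is not a product $\psi_Q\otimes\phi_{\overline Q}$ for any bipartition $Q|\overline Q$ of the parties into two nonempty sets. A behavior $P(\mathbf a|\mathbf x)$ is local across $Q|\overline Q$ if $P(\mathbf a|\mathbf x)=\int P_\lambda(\mathbf a_Q|\mathbf x_Q)\,P'_\lambda(\mathbf a_{\overline Q}|\mathbf x_{\overline Q})\,d\mu(\lambda)$ for a probability measure $\mu$ and non-signaling behaviors $P_\lambda,P'_\lambda$ of $Q$ and $\overline Q$ depending measurably on $\lambda$. Its genuine nonlocality content $\tilde p_{NL}$ is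 the infimum of the $p_{NL}$ occurring in convex decompositions $P=\sum_Q p_{Q}P_{Q}+p_{NL}P_{NL}$ with $P_Q$ local across $Q|\overline Q$ and (if $p_{NL}\neq0$) $P_{NL}$ nonlocal across every bipartition. A state is multipartite fully nonlocal (MFNL) if there are finitely many outcomes and, for each party, a sequence of local measurements (settings $x=0,1,2,\dots$, repetitions allowed) for which the resulting behavior has $\tilde p_{NL}=1$. **Theorem.** Let $\psi$ be a graph state of $G$. 1. $\psi$ is GME if and only if the simple graph on $\{1,\dots,N\}$ with $i\sim j$ iff $d\nmid\Gamma_{ij}$ is connected. 2. If $\psi$ is GME, then $|\psi\rangle\langle\psi|$ is MFNL. Moreover, for every $\varepsilon>0$ there are finitely many local measurements per party, with finitely many outcomes, whose behavior has $\tilde p_{NL}\ge 1-\varepsilon$. 3. Let $i\ne j$, and measure all qudits other than $i,j$ in the computational basis. Every outcome $(a_l)_{l\ne i,j}$ occurs with nonzero probability. The normalized post-measurement state $\psi_{ij}$ of qudits $i,j$ is stabilized by $\omega^{c_i}X_iZ_j^{\Gamma_{ij}}$ and $\omega^{c_j}Z_i^{\Gamma_{ij}}X_j$, where $c_i=\sum_{l\ne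 i,j}\Gamma_{il}a_l$ and $c_j=\sum_{l\neq i,j}\Gamma_{jl}a_l$, and every vector stabilized by these two operators is a scalar multiple of $\psi_{ij}$. Up to local unitaries, $\psi_{ij}$ is the maximally entangled state $q^{-1/2}\sum_{l=0}^{q-1}|ll\rangle$ of Schmidt rank $q=d/\gcd(d,\Gamma_{ij})$, and $q\ge2$ whenever $d\nmid\Gamma_{ij}$. -/

import Mathlib

open scoped Kronecker ComplexOrder

namespace QuditGraph

noncomputable section

/-! ### Generalized Pauli operators and graph states -/

/-- The state space `(ℂ^d)^{⊗N}`, with computational basis indexed by `Fin N → ZMod d`. -/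
abbrev Space (N d : ℕ) : Type := EuclideanSpace ℂ (Fin N → ZMod d)

/-- The product operator `A₁ ⊗ ⋯ ⊗ A_N` on `(ℂ^d)^{⊗N}`. -/
def tensorOp {N d : ℕ} (A : Fin N → Matrix (ZMod d) (ZMod d) ℂ) :
    Matrix (Fin N → ZMod d) (Fin N → ZMod d) ℂ :=
  Matrix.of fun x y => ∏ l, A l (x l) (y l)

/-- The shift `X = ∑ⱼ |j+1⟩⟨j|`. -/
def pauliX (d : ℕ) : Matrix (ZMod d) (ZMod d) ℂ :=
  Matrix.of fun k j => if k = j + 1 then 1 else 0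

/-- The root of unity `exp(2πi/d)`. -/
def omega (d : ℕ) : ℂ := Complex.exp (2 * Real.pi * Complex.I / d)

/-- The clock `Z = ∑ⱼ exp(2πij/d) |j⟩⟨j|`. -/
def pauliZ (d : ℕ) : Matrix (ZMod d) (ZMod d) ℂ :=
  Matrix.diagonal fun j => omega d ^ j.val

/-- The number `Γᵢⱼ` of edges of the multigraph `G` joining `i` and `j`. -/
def edgeMult {V β : Type*} (G : Graph V β) (i j : V) : ℕ := {e | G.IsLink e i j}.ncard

/-- The stabilizing operator `gⱼ = Xⱼ ∏ₗ Zₗ^{Γⱼₗ}`, written as a tensor product over the sites. -/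
def graphGenerator {N : ℕ} {β : Type*} (d : ℕ) [NeZero d] (G : Graph (Fin N) β) (j : Fin N) :
    Matrix (Fin N → ZMod d) (Fin N → ZMod d) ℂ :=
  tensorOp fun l => (if l = j then pauliX d else 1) * pauliZ d ^ edgeMult G j l

/-- `ψ` is a (normalized) graph state of `G`: it is stabilized by all the generators `gⱼ`. -/
def IsGraphState {N d : ℕ} [NeZero d] {β : Type*} (G : Graph (Fin N) β) (ψ : Space N d) : Prop :=
  ‖ψ‖ = 1 ∧ ∀ j, Matrix.toEuclideanLin (graphGenerator d G j) ψ = ψ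

/-- The simple graph in which `i ≠ j` are adjacent when `Γᵢⱼ` is not a multiple of `d`, that is,
when `Z^{Γᵢⱼ} ≠ 1`. -/
def reducedGraph {V β : Type*} (d : ℕ) (G : Graph V β) : SimpleGraph V :=
  SimpleGraph.fromRel fun i j => ¬ d ∣ edgeMult G i j

/-- The bipartitions `Q | Qᶜ` of the parties, given by `Q` nonempty with nonempty complement. -/
def bipartitions (N : ℕ) : Finset (Finset (Fin N)) :=
  Finset.univ.filter fun Q => Q.Nonempty ∧ Qᶜ.Nonempty

/-- Genuine multipartite entanglement of a pure state: not a product across any bipartition. -/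
def IsGME {N d : ℕ} (ψ : Space N d) : Prop :=
  ∀ Q ∈ bipartitions N,
    ¬ ∃ (α : EuclideanSpace ℂ (Q → ZMod d)) (β : EuclideanSpace ℂ ((Qᶜ : Finset (Fin N)) → ZMod d)),
      ∀ x : Fin N → ZMod d, ψ x = α (Q.restrict x) * β (Qᶜ.restrict x)

/-! ### Behaviors and multipartite full nonlocality -/

/-- The numbers `P(a|x)` for parties `ι`, settings `X`, outcomes `K`; `P x a` stands for
`P(a|x)`. -/
abbrev Behavior (ι X K : Type*) : Type _ := (ι → X) → (ι → K) → ℝ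

/-- For every choice of settings, `P(·|x)` is a probability distribution. -/
def IsBehavior {ι X K : Type*} [Fintype ι] [DecidableEq ι] [Fintype K]
    (P : Behavior ι X K) : Prop :=
  (∀ x a, 0 ≤ P x a) ∧ ∀ x, ∑ a, P x a = 1

/-- A non-signaling behavior: for every set `S` of parties, the marginal distribution of the
outcomes of `S` depends only on the settings of `S`. -/
def IsNonSignaling {ι X K : Type*} [Fintype ι] [DecidableEq ι] [Fintype K] [DecidableEq K]
    (P : Behavior ι X K) : Prop :=
  IsBehavior P ∧
    ∀ (S : Finset ι) (x x' : ι → X), (∀ i ∈ S, x i = x' i) → ∀ a : ι → K,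
      ∑ b with ∀ i ∈ S, b i = a i, P x b = ∑ b with ∀ i ∈ S, b i = a i, P x' b

/-- `P` is local with respect to `Q | Qᶜ`: a mixture, over a hidden variable `lam` with an arbitrary
probability distribution, of products of non-signaling behaviors of `Q` and of `Qᶜ`. -/
def IsLocalAcross {N : ℕ} {X K : Type*} [Fintype K] [DecidableEq K] (Q : Finset (Fin N))
    (P : Behavior (Fin N) X K) : Prop :=
  ∃ (Λ : Type) (_ : MeasurableSpace Λ) (μ : MeasureTheory.Measure Λ)
    (PQ : Λ → Behavior Q X K) (PR : Λ → Behavior (Qᶜ : Finset (Fin N)) X K),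
    MeasureTheory.IsProbabilityMeasure μ ∧
    (∀ lam, IsNonSignaling (PQ lam)) ∧ (∀ lam, IsNonSignaling (PR lam)) ∧
    (∀ x a, Measurable fun lam => PQ lam x a) ∧ (∀ x a, Measurable fun lam => PR lam x a) ∧
    ∀ x a, P x a =
      ∫ lam, PQ lam (Q.restrict x) (Q.restrict a) * PR lam (Qᶜ.restrict x) (Qᶜ.restrict a) ∂μ

/-- `P` has a convex decomposition `P = ∑_Q p_Q P_Q + p P_NL` in which each `P_Q` is local with
respect to `Q | Qᶜ`, and `P_NL` (if it occurs, that is, if `p ≠ 0`) is nonlocal across every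
bipartition. -/
def HasDecomposition {N : ℕ} {X K : Type*} [Fintype K] [DecidableEq K]
    (P : Behavior (Fin N) X K) (p : ℝ) : Prop :=
  ∃ (w : Finset (Fin N) → ℝ) (PL : Finset (Fin N) → Behavior (Fin N) X K)
    (PNL : Behavior (Fin N) X K),
    (∀ Q ∈ bipartitions N, 0 ≤ w Q) ∧ 0 ≤ p ∧ ∑ Q ∈ bipartitions N, w Q + p = 1 ∧
    (∀ Q ∈ bipartitions N, IsLocalAcross Q (PL Q)) ∧
    IsBehavior PNL ∧ (p ≠ 0 → ∀ Q ∈ bipartitions N, ¬ IsLocalAcross Q PNL) ∧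
    ∀ x a, P x a = ∑ Q ∈ bipartitions N, w Q * PL Q x a + p * PNL x a

/-- The genuine nonlocality content: the least weight of the nonlocal part in a decomposition. -/
def nonlocalityContent {N : ℕ} {X K : Type*} [Fintype K] [DecidableEq K]
    (P : Behavior (Fin N) X K) : ℝ :=
  sInf {p : ℝ | HasDecomposition P p}

/-- A quantum measurement (POVM) with outcomes `K` on a system with basis `D`. -/
structure Measurement (D K : Type*) [Fintype D] [DecidableEq D] [Fintype K] where
  effect : K → Matrix D D ℂ
  posSemidef : ∀ k, (effect k).PosSemidef
  sum_eq_one : ∑ k, effect k = 1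

/-- The density matrix `|ψ⟩⟨ψ|`. -/
def pureDensity {N d : ℕ} (ψ : Space N d) : Matrix (Fin N → ZMod d) (Fin N → ZMod d) ℂ :=
  Matrix.of fun x y => ψ x * star (ψ y)

/-- The behavior `P(a|x) = Tr[(⊗ᵢ M_{aᵢ|xᵢ}) ρ]` of the state `ρ` under local measurements. -/
def bornBehavior {N d : ℕ} [NeZero d] {X K : Type*} [Fintype K]
    (ρ : Matrix (Fin N → ZMod d) (Fin N → ZMod d) ℂ) (M : Fin N → X → Measurement (ZMod d) K) :
    Behavior (Fin N) X K :=
  fun x a => (Matrix.trace (tensorOp (fun i => (M i (x i)).effect (a i)) * ρ)).re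

/-- The state `ρ` is multipartite fully nonlocal: there are a Bell scenario and local measurements
for which the resulting behavior has nonlocality content `1`. The settings of every party are
`0, 1, 2, …`; a setting may be repeated, so this includes the scenarios with finitely many settings.
-/
def IsMFNL {N d : ℕ} [NeZero d] (ρ : Matrix (Fin N → ZMod d) (Fin N → ZMod d) ℂ) : Prop :=
  ∃ (k : ℕ) (M : Fin N → ℕ → Measurement (ZMod d) (Fin k)),
    nonlocalityContent (bornBehavior ρ M) = 1

/-- With finitely many settings per party, the nonlocality content of the behavior can be brought
arbitrarily close to `1`. -/
def IsFinitelyApproxMFNL {N d : ℕ} [NeZero d]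
    (ρ : Matrix (Fin N → ZMod d) (Fin N → ZMod d) ℂ) : Prop :=
  ∀ ε : ℝ, 0 < ε → ∃ (m k : ℕ) (M : Fin N → Fin m → Measurement (ZMod d) (Fin k)),
    1 - ε ≤ nonlocalityContent (bornBehavior ρ M)

/-! ### Two-qudit states left by measuring the other qudits -/

/-- The space `ℂ^d ⊗ ℂ^d` of two qudits. -/
abbrev PairSpace (d : ℕ) : Type := EuclideanSpace ℂ (ZMod d × ZMod d)

/-- The unnormalized state `(⊗_{l ≠ i,j} ⟨aₗ|) ψ` of the qudits `i`, `j` after a computational-basis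
measurement of all the others with outcomes `aₗ` (the values `aᵢ`, `aⱼ` are ignored). -/
def condVec {N d : ℕ} (ψ : Space N d) (i j : Fin N) (a : Fin N → ZMod d) : PairSpace d :=
  WithLp.toLp 2 fun p => ψ (Function.update (Function.update a i p.1) j p.2)

/-- The normalized post-measurement state of the qudits `i`, `j`. -/
def postState {N d : ℕ} [NeZero d] (ψ : Space N d) (i j : Fin N) (a : Fin N → ZMod d) :
    PairSpace d :=
  ((‖condVec ψ i j a‖⁻¹ : ℝ) : ℂ) • condVec ψ i j a

/-- The standard state `q^{-1/2} ∑_{l < q} |l l⟩`. -/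
def maxEntangled (d q : ℕ) : PairSpace d :=
  WithLp.toLp 2 fun p => if p.1 = p.2 ∧ p.1.val < q then ((Real.sqrt q)⁻¹ : ℂ) else 0

/-- `φ` is, up to local unitaries, the maximally entangled state of Schmidt rank `q`. -/
def IsMaximallyEntangled {d : ℕ} [NeZero d] (q : ℕ) (φ : PairSpace d) : Prop :=
  ∃ U ∈ Matrix.unitaryGroup (ZMod d) ℂ, ∃ V ∈ Matrix.unitaryGroup (ZMod d) ℂ,
    Matrix.toEuclideanLin (U ⊗ₖ V) φ = maxEntangled d q

/-- `φ` is stabilized by `ω^{cᵢ} Xᵢ Zⱼ^γ` and `ω^{cⱼ} Zᵢ^γ Xⱼ`. -/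
def IsPairStabilized {d : ℕ} [NeZero d] (γ ci cj : ℕ) (φ : PairSpace d) : Prop :=
  Matrix.toEuclideanLin (omega d ^ ci • (pauliX d ⊗ₖ (pauliZ d ^ γ))) φ = φ ∧
  Matrix.toEuclideanLin (omega d ^ cj • ((pauliZ d ^ γ) ⊗ₖ pauliX d)) φ = φ

/-- The exponent `∑_{l ≠ i,j} Γᵢₗ aₗ` of the phase produced by the outcomes `a`. -/
def outcomePhase {N d : ℕ} {β : Type*} (G : Graph (Fin N) β) (i j : Fin N)
    (a : Fin N → ZMod d) : ℕ :=
  ∑ l with l ≠ i ∧ l ≠ j, edgeMult G i l * (a l).val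

end

end QuditGraph

open QuditGraph

/-!
The stabilizer equations shift one coordinate of the amplitude function at a time, so they determine
a graph state up to a scalar: `ψ x = ψ 0 * ω ^ ∑_{i<k} Γᵢₖ xᵢ xₖ` (`IsGraphState.apply_eq`). Fixing
all coordinates but those of `i` and `j` leaves the phase `Γᵢⱼ xᵢ xⱼ + cᵢ xᵢ + cⱼ xⱼ`, which gives the
statements on post-measurement states. As a matrix in `xᵢ`, `xⱼ` this is, up to diagonal unitaries, a
`q × q` Fourier matrix tensored with an all-ones block, whence the `q` equal Schmidt coefficients
(`isMaximallyEntangled_of_apply_eq`). The quadratic form splits along a cut that no edge of the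
reduced graph crosses, while a crossing edge yields a nonzero `2 × 2` minor of the amplitudes
(`IsGraphState.isGME_iff`).

For full nonlocality, fix a bipartition and an edge `i`, `j` of the reduced graph that crosses it. If
all other parties measure in the computational basis and obtain `a`, then `i` and `j` share a
maximally entangled state of Schmidt rank `q ≥ 2`. On such a state, Fourier measurements whose angles
advance in `2(n + 1)` small steps give outcomes that agree along the whole chain, and are shifted
cyclically at its ends, except with probability `O(1/n)` (`exists_chainSum_le`). Every hidden-variable
strategy that is local across the cut must break one of these relations
(`IsLocalAcross.le_chainSum`), so the local part has joint weight `O(1/n)` with `a`.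

The pair state, and hence the chain, depends on `a`, which `i` and `j` do not know. Postselecting on a
single `a` would only bound the part of the local weight that produces this `a`; so the parties are
given the chains for all values of `a`, and the bounds are added up over `a`
(`IsChainedAcross.weight_le`). Chains of one length `n` use finitely many settings and give content
`≥ 1 - ε`; the countably many settings of all lengths together give content `1`.
-/

open ZMod (stdAddChar)

namespace QuditGraph

variable {N d : ℕ}

/-! ### The amplitudes of a graph state -/

theorem edgeMult_comm {V β : Type*} (G : Graph V β) (i j : V) :
    edgeMult G i j = edgeMult G j i := by
  simp only [edgeMult, G.isLink_comm]

theorem edgeMult_self {V β : Type*} (G : Graph V β) [G.Loopless] (i : V) :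
    edgeMult G i i = 0 := by
  have : {e | G.IsLink e i i} = ∅ := by
    ext e
    simp only [Set.mem_ofPred_eq, Set.mem_empty_iff_false, iff_false]
    exact fun h => h.ne rfl
  rw [edgeMult, this, Set.ncard_empty]

theorem omega_pow {d : ℕ} [NeZero d] (n : ℕ) : omega d ^ n = stdAddChar (n : ZMod d) := by
  have := ZMod.stdAddChar_coe (N := d) (n : ℤ)
  rw [Int.cast_natCast] at this
  rw [this, omega, ← Complex.exp_nat_mul]
  congr 1
  push_cast
  ring

theorem stdAddChar_ne_zero {d : ℕ} [NeZero d] (a : ZMod d) : (stdAddChar a : ℂ) ≠ 0 := by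
  rw [ZMod.stdAddChar_apply]
  exact Circle.coe_ne_zero _

theorem pauliZ_pow {d : ℕ} [NeZero d] (n : ℕ) :
    pauliZ d ^ n = Matrix.diagonal fun j => stdAddChar ((n : ZMod d) * j) := by
  rw [pauliZ, Matrix.diagonal_pow]
  congr 1
  ext j
  rw [Pi.pow_apply, ← pow_mul, omega_pow]
  congr 1
  push_cast
  rw [ZMod.natCast_zmod_val, mul_comm]

theorem stdAddChar_sum {d : ℕ} [NeZero d] {ι : Type*} (s : Finset ι) (f : ι → ZMod d) :
    (stdAddChar (∑ i ∈ s, f i) : ℂ) = ∏ i ∈ s, stdAddChar (f i) := by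
  classical
  induction s using Finset.induction_on with
  | empty => simp
  | insert i s hi ih => rw [Finset.sum_insert hi, Finset.prod_insert hi, AddChar.map_add_eq_mul, ih]

/-- The quadratic form `∑_{i<k} Γᵢₖ xᵢ xₖ` whose values are the phases of a graph state. -/
def graphPhase (Γ : Fin N → Fin N → ZMod d) (x : Fin N → ZMod d) : ZMod d :=
  ∑ i, ∑ k, if i < k then Γ i k * x i * x k else 0

theorem graphPhase_update {Γ : Fin N → Fin N → ZMod d} (hs : ∀ i j, Γ i j = Γ j i)
    (h0 : ∀ i, Γ i i = 0) (x : Fin N → ZMod d) (j : Fin N) (t : ZMod d) :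
    graphPhase Γ (Function.update x j t) =
      graphPhase Γ (Function.update x j 0) + t * ∑ l, Γ j l * x l := by
  have key : ∀ i k : Fin N,
      (if i < k then Γ i k * Function.update x j t i * Function.update x j t k else 0) =
      (if i < k then Γ i k * Function.update x j 0 i * Function.update x j 0 k else 0) +
      ((if i = j then (if i < k then t * (Γ i k * x k) else 0) else 0) +
      (if k = j then (if i < k then t * (Γ i k * x i) else 0) else 0)) := by
    intro i k
    by_cases hik : i < k
    · by_cases hi : i = j
      · subst hi
        simp [hik, hik.ne']
        ring
      · by_cases hk : k = j
        · subst hk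
          simp [hik, hi]
          ring
        · simp [hi, hk]
    · simp [hik]
  unfold graphPhase
  simp_rw [key, Finset.sum_add_distrib]
  congr 1
  have e1 : ∑ i, ∑ k, (if i = j then (if i < k then t * (Γ i k * x k) else 0) else 0)
      = ∑ k, if j < k then t * (Γ j k * x k) else 0 := by
    rw [Finset.sum_eq_single j] <;> simp +contextual
  have e2 : ∑ i, ∑ k, (if k = j then (if i < k then t * (Γ i k * x i) else 0) else 0)
      = ∑ k, if k < j then t * (Γ j k * x k) else 0 := by
    refine Finset.sum_congr rfl fun i _ => ?_
    rw [Finset.sum_ite_eq' Finset.univ j]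
    simp [hs i j]
  rw [e1, e2, ← Finset.sum_add_distrib, Finset.mul_sum]
  refine Finset.sum_congr rfl fun k _ => ?_
  rcases lt_trichotomy j k with h | h | h
  · simp [h, h.not_gt]
  · subst h; simp [h0]
  · simp [h, h.not_gt]

theorem graphGenerator_apply [NeZero d] {β : Type*} (G : Graph (Fin N) β) [G.Loopless] (j : Fin N)
    (ψ : Space N d) (x : Fin N → ZMod d) :
    Matrix.toEuclideanLin (graphGenerator d G j) ψ x =
      stdAddChar (∑ l, (edgeMult G j l : ZMod d) * x l) * ψ (Function.update x j (x j - 1)) := by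
  rw [Matrix.toEuclideanLin, Matrix.toLpLin_apply]
  simp only [Matrix.mulVec, dotProduct]
  have entry : ∀ y, graphGenerator d G j x y =
      if y = Function.update x j (x j - 1) then
        stdAddChar (∑ l, (edgeMult G j l : ZMod d) * x l) else 0 := by
    intro y
    simp only [graphGenerator, tensorOp, Matrix.of_apply, pauliZ_pow, Matrix.mul_diagonal]
    split_ifs with h
    · subst h
      rw [stdAddChar_sum]
      refine Finset.prod_congr rfl fun l _ => ?_
      by_cases hl : l = j
      · subst hl
        simp [pauliX, edgeMult_self]
      · simp [hl, Matrix.one_apply]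
    · have : ∃ l, y l ≠ Function.update x j (x j - 1) l := by
        by_contra! hc
        exact h (funext hc)
      obtain ⟨l, hl⟩ := this
      refine Finset.prod_eq_zero (Finset.mem_univ l) ?_
      by_cases hlj : l = j
      · subst hlj
        have : x l ≠ y l + 1 := by
          intro hx
          exact hl (by simp [hx])
        simp [pauliX, this]
      · have : x l ≠ y l := by
          intro hx
          exact hl (by simp [hlj, hx])
        simp [hlj, this]
  simp [entry]

/-- The stabilizer equations determine a graph state up to a scalar: its amplitudes are a
constant times the phases `ω ^ ∑_{i<k} Γᵢₖ xᵢ xₖ`. -/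
theorem IsGraphState.apply_eq [NeZero d] {β : Type*} {G : Graph (Fin N) β} [G.Loopless]
    {ψ : Space N d}
    (hψ : IsGraphState G ψ) (x : Fin N → ZMod d) :
    ψ x = ψ 0 * stdAddChar (graphPhase (fun i j => (edgeMult G i j : ZMod d)) x) := by
  set Γ : Fin N → Fin N → ZMod d := fun i j => (edgeMult G i j : ZMod d) with hΓ
  have hs : ∀ i j, Γ i j = Γ j i := fun i j => by simp only [hΓ, edgeMult_comm G i j]
  have h0 : ∀ i, Γ i i = 0 := fun i => by simp [hΓ, edgeMult_self]
  -- Removing the expected phase leaves a function invariant under every shift of a coordinate.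
  set r : (Fin N → ZMod d) → ℂ := fun x => ψ x * stdAddChar (-graphPhase Γ x) with hr
  have step : ∀ j x, r x = r (Function.update x j (x j - 1)) := by
    intro j x
    have h1 : ψ x = stdAddChar (∑ l, Γ j l * x l) * ψ (Function.update x j (x j - 1)) := by
      conv_lhs => rw [← hψ.2 j]
      exact graphGenerator_apply G j ψ x
    have h2 := graphPhase_update hs h0 x j (x j)
    have h3 := graphPhase_update hs h0 x j (x j - 1)
    rw [Function.update_eq_self] at h2
    simp only [hr]
    rw [h1, h2, h3, mul_comm (stdAddChar _) (ψ _), mul_assoc, ← AddChar.map_add_eq_mul]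
    congr 2
    ring
  have shift : ∀ j x (n : ℕ), r (Function.update x j (x j + n)) = r x := by
    intro j x n
    induction n with
    | zero => simp
    | succ n ih =>
      rw [step j, ← ih]
      simp [← add_assoc]
  have upd : ∀ j x t, r (Function.update x j t) = r x := by
    intro j x t
    have := shift j x (t - x j).val
    rwa [ZMod.natCast_zmod_val, add_sub_cancel] at this
  have const : ∀ S : Finset (Fin N), ∀ x, (∀ l ∉ S, x l = 0) → r x = r 0 := by
    intro S
    induction S using Finset.induction_on with
    | empty => intro x hx; rw [show x = 0 from funext fun l => hx l (by simp)]
    | insert j S _ ih =>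
      intro x hx
      rw [← upd j x 0]
      refine ih _ fun l hl => ?_
      by_cases hlj : l = j
      · simp [hlj]
      · simpa [hlj] using hx l (by simp [hlj, hl])
  have h := const Finset.univ x (by simp)
  have hz : graphPhase Γ 0 = 0 := by simp [graphPhase]
  simp only [hr, hz, neg_zero, AddChar.map_zero_eq_one, mul_one] at h
  rw [← h, mul_assoc, ← AddChar.map_add_eq_mul]
  simp

theorem IsGraphState.apply_zero_ne_zero [NeZero d] {β : Type*} {G : Graph (Fin N) β} [G.Loopless]
    {ψ : Space N d} (hψ : IsGraphState G ψ) : ψ 0 ≠ 0 := by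
  intro h
  have : ψ = 0 := by
    ext x
    rw [hψ.apply_eq, h]
    simp
  have h1 := hψ.1
  simp [this] at h1

/-! ### Genuine multipartite entanglement -/

theorem exists_adj_crossing_of_connected {V : Type*} {H : SimpleGraph V} (hH : H.Connected)
    {S : Set V} {u v : V} (hu : u ∈ S) (hv : v ∉ S) : ∃ i ∈ S, ∃ j ∉ S, H.Adj i j := by
  obtain ⟨p⟩ := hH.preconnected u v
  obtain ⟨e, -, h1, h2⟩ := p.exists_boundary_dart S hu hv
  exact ⟨_, h1, _, h2, e.adj⟩

theorem exists_crossing_of_connected {β : Type*} {G : Graph (Fin N) β}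
    (hG : (reducedGraph d G).Connected) {Q : Finset (Fin N)} (hQ : Q ∈ bipartitions N) :
    ∃ i ∈ Q, ∃ j ∈ Qᶜ, ¬ d ∣ edgeMult G i j := by
  obtain ⟨⟨u, hu⟩, ⟨v, hv⟩⟩ := (Finset.mem_filter.1 hQ).2
  obtain ⟨i, hi, j, hj, hij⟩ := exists_adj_crossing_of_connected hG (S := (Q : Set (Fin N)))
    (Finset.mem_coe.2 hu) (fun h => Finset.mem_compl.1 hv h)
  refine ⟨i, hi, j, Finset.mem_compl.2 hj, ?_⟩
  rw [reducedGraph, SimpleGraph.fromRel_adj] at hij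
  rcases hij.2 with h | h
  · exact h
  · rwa [edgeMult_comm]

theorem exists_uncrossed_of_not_connected [NeZero N] {β : Type*} {G : Graph (Fin N) β}
    (hG : ¬ (reducedGraph d G).Connected) :
    ∃ Q ∈ bipartitions N, ∀ i ∈ Q, ∀ j ∈ Qᶜ, d ∣ edgeMult G i j := by
  classical
  have : ¬ (reducedGraph d G).Preconnected := fun h => hG ⟨h⟩
  simp only [SimpleGraph.Preconnected, not_forall] at this
  obtain ⟨u, v, huv⟩ := this
  refine ⟨Finset.univ.filter fun w => (reducedGraph d G).Reachable u w, ?_, ?_⟩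
  · simp only [bipartitions, Finset.mem_filter, Finset.mem_univ, true_and]
    exact ⟨⟨u, by simp⟩, ⟨v, by simpa using huv⟩⟩
  · intro i hi j hj
    by_contra hd
    simp only [Finset.mem_filter, Finset.mem_univ, true_and, Finset.mem_compl] at hi hj
    refine hj (hi.trans (SimpleGraph.Adj.reachable ?_))
    rw [reducedGraph, SimpleGraph.fromRel_adj]
    exact ⟨fun h => hj (h ▸ hi), Or.inl hd⟩

theorem graphPhase_update_update {Γ : Fin N → Fin N → ZMod d} (hs : ∀ i j, Γ i j = Γ j i)
    (h0 : ∀ i, Γ i i = 0) (a : Fin N → ZMod d) {i j : Fin N} (hij : i ≠ j) (s t : ZMod d) :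
    graphPhase Γ (Function.update (Function.update a i s) j t) =
      graphPhase Γ (Function.update (Function.update a i 0) j 0) + Γ i j * s * t +
      (∑ l with l ≠ i ∧ l ≠ j, Γ i l * a l) * s + (∑ l with l ≠ i ∧ l ≠ j, Γ j l * a l) * t := by
  have aux : ∀ {i j : Fin N}, i ≠ j → ∀ u, ∑ l, Γ j l * Function.update a i u l =
      Γ j i * u + ∑ l with l ≠ i ∧ l ≠ j, Γ j l * a l := by
    intro i j hij u
    rw [← Finset.add_sum_erase _ _ (Finset.mem_univ i), Function.update_self]
    congr 1
    rw [Finset.sum_filter, ← Finset.add_sum_erase _ _ (Finset.mem_univ i)]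
    simp only [ne_eq, not_true_eq_false, false_and, if_false, zero_add]
    refine Finset.sum_congr rfl fun l hl => ?_
    have hli := Finset.ne_of_mem_erase hl
    by_cases hlj : l = j
    · subst hlj; simp [h0]
    · simp [hli, hlj]
  rw [graphPhase_update hs h0, Function.update_comm hij s 0 a,
    graphPhase_update hs h0 (Function.update a j 0) i s, aux hij, aux hij.symm,
    ← Function.update_comm hij 0 0 a, hs j i]
  have : (∑ l with l ≠ j ∧ l ≠ i, Γ i l * a l) = ∑ l with l ≠ i ∧ l ≠ j, Γ i l * a l := by
    simp only [and_comm]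
  rw [this]
  ring

/-- A graph state is a product across every cut that no edge of the reduced graph crosses; an edge
between `i` and `j` that crosses the cut obstructs this, because the amplitudes with
`xᵢ, xⱼ ∈ {0, 1}` then have the nonzero minor `ω ^ Γᵢⱼ - 1`. -/
theorem IsGraphState.isGME_iff [NeZero N] [NeZero d] {β : Type*} {G : Graph (Fin N) β} [G.Loopless]
    {ψ : Space N d} (hψ : IsGraphState G ψ) : IsGME ψ ↔ (reducedGraph d G).Connected := by
  set Γ : Fin N → Fin N → ZMod d := fun i j => (edgeMult G i j : ZMod d) with hΓ
  have hs : ∀ i j, Γ i j = Γ j i := fun i j => by simp only [hΓ, edgeMult_comm G i j]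
  have h0 : ∀ i, Γ i i = 0 := fun i => by simp [hΓ, edgeMult_self]
  have hψ0 := hψ.apply_zero_ne_zero
  constructor
  · intro hgme
    by_contra hG
    obtain ⟨Q, hQ, hcross⟩ := exists_uncrossed_of_not_connected hG
    have hz : ∀ i ∈ Q, ∀ j ∉ Q, Γ i j = 0 := fun i hi j hj =>
      (ZMod.natCast_eq_zero_iff _ _).2 (hcross i hi j (Finset.mem_compl.2 hj))
    refine hgme Q hQ ⟨WithLp.toLp 2 fun u => ψ (fun l => if h : l ∈ Q then u ⟨l, h⟩ else 0),
      WithLp.toLp 2 fun v => stdAddChar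
        (graphPhase Γ fun l => if h : l ∈ Qᶜ then v ⟨l, h⟩ else 0), fun x => ?_⟩
    simp only [Finset.restrict_def]
    suffices hsplit : graphPhase Γ x = graphPhase Γ (fun l => if l ∈ Q then x l else 0) +
        graphPhase Γ (fun l => if l ∈ Qᶜ then x l else 0) by
      rw [hψ.apply_eq x, hψ.apply_eq fun l => if h : l ∈ Q then x l else 0, mul_assoc,
        ← AddChar.map_add_eq_mul]
      simp only [dite_eq_ite]
      rw [← hsplit]
    unfold graphPhase
    rw [← Finset.sum_add_distrib]
    simp_rw [← Finset.sum_add_distrib]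
    refine Finset.sum_congr rfl fun i _ => Finset.sum_congr rfl fun k _ => ?_
    by_cases hik : i < k
    · by_cases hi : i ∈ Q <;> by_cases hk : k ∈ Q
      · simp [hik, hi, hk]
      · have := hz i hi k hk
        simp [hi, hk, this]
      · have := hz k hk i hi
        rw [hs] at this
        simp [hi, hk, this]
      · simp [hik, hi, hk]
    · simp [hik]
  · rintro hG Q hQ ⟨α, γ, hprod⟩
    obtain ⟨i, hi, j, hj, hij⟩ := exists_crossing_of_connected hG hQ
    have hj' := Finset.mem_compl.1 hj
    have hne : i ≠ j := fun h => hj' (h ▸ hi)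
    set y : ZMod d → ZMod d → Fin N → ZMod d :=
      fun s t => Function.update (Function.update 0 i s) j t with hy
    have hψy : ∀ s t, ψ (y s t) = ψ 0 * stdAddChar (Γ i j * s * t) := by
      intro s t
      rw [hψ.apply_eq]
      congr 2
      rw [hy, graphPhase_update_update hs h0 0 hne]
      simp [graphPhase, hΓ]
    have hQy : ∀ s t, Q.restrict (y s t) = Q.restrict (y s 0) := by
      intro s t
      ext ⟨l, hl⟩
      have : l ≠ j := fun h => hj' (h ▸ hl)
      simp [hy, Finset.restrict, this]
    have hRy : ∀ s t, Qᶜ.restrict (y s t) = Qᶜ.restrict (y 0 t) := by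
      intro s t
      ext ⟨l, hl⟩
      have : l ≠ i := fun h => Finset.mem_compl.1 hl (h ▸ hi)
      by_cases hlj : l = j
      · subst hlj; simp [hy, Finset.restrict]
      · simp [hy, Finset.restrict, this, hlj]
    have hminor : ψ (y 1 1) * ψ (y 0 0) = ψ (y 1 0) * ψ (y 0 1) := by
      rw [hprod, hprod (y 0 0), hprod (y 1 0), hprod (y 0 1), hQy 1 1, hRy 1 1, hRy 1 0, hQy 0 1]
      ring
    simp only [hψy, mul_one, mul_zero, AddChar.map_zero_eq_one] at hminor
    have h1 : (stdAddChar (Γ i j) : ℂ) = stdAddChar (0 : ZMod d) := by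
      rw [AddChar.map_zero_eq_one]
      have h2 : ψ 0 * ψ 0 ≠ 0 := mul_ne_zero hψ0 hψ0
      apply mul_left_cancel₀ h2
      linear_combination hminor
    exact hij ((ZMod.natCast_eq_zero_iff _ _).1 (ZMod.injective_stdAddChar h1))

/-! ### The pair states left by computational-basis measurements -/

theorem kronecker_pauli_apply_left [NeZero d] (γ c : ℕ) (φ : PairSpace d) (p : ZMod d × ZMod d) :
    Matrix.toEuclideanLin (omega d ^ c • (pauliX d ⊗ₖ (pauliZ d ^ γ))) φ p =
      stdAddChar ((c : ZMod d) + (γ : ZMod d) * p.2) * φ (p.1 - 1, p.2) := by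
  obtain ⟨s, t⟩ := p
  have h : ∀ y : ZMod d, (s = y + 1) = (y = s - 1) := fun y =>
    propext ⟨fun h => by rw [h]; ring, fun h => by rw [h]; ring⟩
  rw [Matrix.toEuclideanLin, Matrix.toLpLin_apply]
  simp only [Matrix.mulVec, dotProduct, Fintype.sum_prod_type, pauliZ_pow, omega_pow, pauliX,
    Matrix.smul_apply, Matrix.kroneckerMap_apply, Matrix.of_apply, Matrix.diagonal_apply, h,
    AddChar.map_add_eq_mul]
  simp [mul_assoc]

theorem kronecker_pauli_apply_right [NeZero d] (γ c : ℕ) (φ : PairSpace d) (p : ZMod d × ZMod d) :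
    Matrix.toEuclideanLin (omega d ^ c • ((pauliZ d ^ γ) ⊗ₖ pauliX d)) φ p =
      stdAddChar ((c : ZMod d) + (γ : ZMod d) * p.1) * φ (p.1, p.2 - 1) := by
  obtain ⟨s, t⟩ := p
  have h : ∀ y : ZMod d, (t = y + 1) = (y = t - 1) := fun y =>
    propext ⟨fun h => by rw [h]; ring, fun h => by rw [h]; ring⟩
  rw [Matrix.toEuclideanLin, Matrix.toLpLin_apply]
  simp only [Matrix.mulVec, dotProduct, Fintype.sum_prod_type, pauliZ_pow, omega_pow, pauliX,
    Matrix.smul_apply, Matrix.kroneckerMap_apply, Matrix.of_apply, Matrix.diagonal_apply, h,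
    AddChar.map_add_eq_mul]
  simp [mul_assoc]

theorem isPairStabilized_iff [NeZero d] {γ ci cj : ℕ} {φ : PairSpace d} :
    IsPairStabilized γ ci cj φ ↔
      ∃ c : ℂ, ∀ p, φ p = c *
        stdAddChar ((γ : ZMod d) * p.1 * p.2 + (ci : ZMod d) * p.1 + (cj : ZMod d) * p.2) := by
  constructor
  · rintro ⟨h1, h2⟩
    set f : ZMod d → ZMod d → ZMod d := fun s t => (γ : ZMod d) * s * t + ci * s + cj * t with hf
    set r : ZMod d → ZMod d → ℂ := fun s t => φ (s, t) * stdAddChar (-f s t) with hr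
    have e1 : ∀ s t, r s t = r (s - 1) t := by
      intro s t
      have := kronecker_pauli_apply_left γ ci φ (s, t)
      rw [h1] at this
      simp only [hr]
      rw [this, mul_comm (stdAddChar _) (φ _), mul_assoc, ← AddChar.map_add_eq_mul]
      congr 2
      simp only [hf]
      ring
    have e2 : ∀ s t, r s t = r s (t - 1) := by
      intro s t
      have := kronecker_pauli_apply_right γ cj φ (s, t)
      rw [h2] at this
      simp only [hr]
      rw [this, mul_comm (stdAddChar _) (φ _), mul_assoc, ← AddChar.map_add_eq_mul]
      congr 2
      simp only [hf]
      ring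
    have n1 : ∀ (n : ℕ) t, r n t = r 0 t := by
      intro n t
      induction n with
      | zero => simp
      | succ n ih => rw [e1, ← ih]; simp
    have n2 : ∀ (n : ℕ), r 0 n = r 0 0 := by
      intro n
      induction n with
      | zero => simp
      | succ n ih => rw [e2, ← ih]; simp
    refine ⟨r 0 0, fun ⟨s, t⟩ => ?_⟩
    have h := n1 s.val t
    have h' := n2 t.val
    rw [ZMod.natCast_zmod_val] at h h'
    rw [← h', ← h]
    simp only [hr, hf]
    rw [mul_assoc, ← AddChar.map_add_eq_mul, neg_add_cancel, AddChar.map_zero_eq_one, mul_one]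
  · rintro ⟨c, hc⟩
    constructor
    · ext p
      rw [kronecker_pauli_apply_left, hc, hc, mul_left_comm, ← AddChar.map_add_eq_mul]
      congr 2
      ring
    · ext p
      rw [kronecker_pauli_apply_right, hc, hc, mul_left_comm, ← AddChar.map_add_eq_mul]
      congr 2
      ring

/-- A Schmidt decomposition with `q` equal coefficients exhibits a maximally entangled state. -/
theorem isMaximallyEntangled_of_schmidt [NeZero d] {q : ℕ} {φ : PairSpace d}
    {u v : ZMod d → EuclideanSpace ℂ (ZMod d)}
    (hu : Orthonormal ℂ (({k | k.val < q} : Set (ZMod d)).domRestrict u))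
    (hv : Orthonormal ℂ (({k | k.val < q} : Set (ZMod d)).domRestrict v))
    (hφ : ∀ p, φ p = (Real.sqrt q : ℂ)⁻¹ * ∑ k with k.val < q, u k p.1 * v k p.2) :
    IsMaximallyEntangled q φ := by
  have key : ∀ w : ZMod d → EuclideanSpace ℂ (ZMod d),
      Orthonormal ℂ (({k | k.val < q} : Set (ZMod d)).domRestrict w) →
      ∃ U ∈ Matrix.unitaryGroup (ZMod d) ℂ,
        ∀ k : ZMod d, k.val < q → ∀ l, ∑ x, U l x * w k x = if l = k then 1 else 0 := by
    intro w hw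
    obtain ⟨b, hb⟩ := hw.exists_orthonormalBasis_extension_of_card_eq (by simp)
    have horth : ∀ l k, ∑ x, star (b l x) * b k x = if l = k then 1 else 0 := by
      intro l k
      have := orthonormal_iff_ite.1 b.orthonormal l k
      rw [PiLp.inner_apply] at this
      rw [← this]
      refine Finset.sum_congr rfl fun x _ => ?_
      rw [RCLike.inner_apply, mul_comm]
      rfl
    refine ⟨Matrix.of fun l x => star (b l x), ?_, fun k hk l => ?_⟩
    · rw [Matrix.mem_unitaryGroup_iff]
      ext l k
      simp only [Matrix.mul_apply, Matrix.star_apply, Matrix.of_apply, star_star, horth,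
        Matrix.one_apply]
    · rw [← hb k hk]
      exact horth l k
  obtain ⟨U, hU, hU'⟩ := key u hu
  obtain ⟨V, hV, hV'⟩ := key v hv
  refine ⟨U, hU, V, hV, ?_⟩
  ext ⟨l, m⟩
  rw [Matrix.toEuclideanLin, Matrix.toLpLin_apply]
  have e : ∀ k : ZMod d, k.val < q → ∑ x, ∑ y, U l x * V m y * (u k x * v k y) =
      (if l = k then 1 else 0) * (if m = k then 1 else 0) := by
    intro k hk
    rw [← hU' k hk l, ← hV' k hk m, Finset.sum_mul_sum]
    exact Finset.sum_congr rfl fun x _ => Finset.sum_congr rfl fun y _ => by ring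
  calc ((U ⊗ₖ V).mulVec φ.ofLp) (l, m)
      = (Real.sqrt q : ℂ)⁻¹ *
          ∑ k with ZMod.val k < q, ∑ x, ∑ y, U l x * V m y * (u k x * v k y) := by
        simp only [Matrix.mulVec, dotProduct, Fintype.sum_prod_type, Matrix.kroneckerMap_apply, hφ]
        rw [Finset.mul_sum]
        simp_rw [Finset.mul_sum]
        symm
        rw [Finset.sum_comm]
        refine Finset.sum_congr rfl fun x _ => ?_
        rw [Finset.sum_comm]
        exact Finset.sum_congr rfl fun y _ => Finset.sum_congr rfl fun k _ => by ring
    _ = maxEntangled d q (l, m) := by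
        rw [Finset.sum_congr rfl fun k hk => e k (Finset.mem_filter.1 hk).2]
        simp only [maxEntangled, mul_ite, mul_one, mul_zero, Finset.sum_ite_eq,
          Finset.mem_filter, Finset.mem_univ, true_and]
        by_cases hml : l = m
        · subst hml
          by_cases hl : l.val < q <;> simp [hl]
        · simp [hml]

theorem card_filter_val_mod [NeZero d] {q g : ℕ} (hd : d = q * g) {k : ℕ} (hk : k < q) :
    (Finset.univ.filter fun b : ZMod d => b.val % q = k).card = g := by
  have hval : ∀ t < g, ((k + q * t : ℕ) : ZMod d).val = k + q * t := by
    intro t ht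
    apply ZMod.val_natCast_of_lt
    calc k + q * t < q + q * t := by omega
      _ = q * (t + 1) := by ring
      _ ≤ d := by rw [hd]; exact Nat.mul_le_mul_left q ht
  have hq : 0 < q := by omega
  rw [← Finset.card_range g]
  symm
  refine Finset.card_nbij' (fun t => ((k + q * t : ℕ) : ZMod d)) (fun b => b.val / q) ?_ ?_ ?_ ?_
  · intro t ht
    have ht := Finset.mem_range.1 ht
    simp only [Finset.coe_filter, Finset.mem_univ, true_and, Set.mem_ofPred_eq, hval t ht,
      Nat.add_mul_mod_self_left, Nat.mod_eq_of_lt hk]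
  · intro b hb
    have := ZMod.val_lt b
    simp only [Finset.mem_coe, Finset.mem_range]
    rw [Nat.div_lt_iff_lt_mul hq, mul_comm]
    omega
  · intro t ht
    have ht := Finset.mem_range.1 ht
    simp only [hval t ht, Nat.add_mul_div_left _ _ hq, Nat.div_eq_of_lt hk, zero_add]
  · intro b hb
    have hb : b.val % q = k := (Finset.mem_filter.1 hb).2
    simp only
    rw [← hb, Nat.mod_add_div, ZMod.natCast_zmod_val]

/-- The matrix `ω ^ (γst)` depends on `s` and `t` modulo `q = d / gcd(d, γ)` only, and is a multiple
of a unitary Fourier matrix on the residues: so its `q` nonzero singular values are equal. -/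
theorem isMaximallyEntangled_of_apply_eq [NeZero d] {γ : ℕ} {φ : PairSpace d} {z : ℂ}
    (hz : ‖z‖ = 1) (α β : ZMod d)
    (hφ : ∀ p, φ p = z / d * stdAddChar ((γ : ZMod d) * p.1 * p.2 + α * p.1 + β * p.2)) :
    IsMaximallyEntangled (d / Nat.gcd d γ) φ := by
  have hd0 : 0 < d := Nat.pos_of_ne_zero (NeZero.ne d)
  set g := Nat.gcd d γ with hg
  set q := d / g with hq
  have hgpos : 0 < g := Nat.gcd_pos_of_pos_left _ hd0
  have hqg : d = q * g := (Nat.div_mul_cancel (Nat.gcd_dvd_left d γ)).symm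
  have hqpos : 0 < q := Nat.div_pos (Nat.le_of_dvd hd0 (Nat.gcd_dvd_left d γ)) hgpos
  have hdvd : ∀ n : ℤ, (d : ℤ) ∣ γ * n → (q : ℤ) ∣ n := by
    intro n hn
    obtain ⟨γ', hγ'⟩ : g ∣ γ := Nat.gcd_dvd_right d γ
    have hcop : Nat.Coprime q γ' := by
      have := Nat.coprime_div_gcd_div_gcd (m := d) (n := γ) hgpos
      rwa [← hg, ← hq, hγ', Nat.mul_div_cancel_left _ hgpos] at this
    have h1 : (g : ℤ) * q ∣ g * (γ' * n) := by
      have : (g : ℤ) * (γ' * n) = γ * n := by rw [hγ']; push_cast; ring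
      rw [this, mul_comm, ← Nat.cast_mul, ← hqg]
      exact hn
    exact (Nat.isCoprime_iff_coprime.2 hcop).dvd_of_dvd_mul_left
      (Int.dvd_of_mul_dvd_mul_left (by exact_mod_cast hgpos.ne') h1)
  have hperiod : ∀ b : ZMod d, (γ : ZMod d) * b = γ * ((b.val % q : ℕ) : ZMod d) := by
    intro b
    have h0 : (γ : ZMod d) * q = 0 := by
      rw [← Nat.cast_mul, ZMod.natCast_eq_zero_iff]
      obtain ⟨γ', hγ'⟩ : g ∣ γ := Nat.gcd_dvd_right d γ
      exact ⟨γ', by rw [hγ', hqg]; ring⟩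
    conv_lhs => rw [← ZMod.natCast_zmod_val b, ← Nat.mod_add_div b.val q]
    push_cast
    rw [mul_add, ← mul_assoc, h0, zero_mul, add_zero]
  set u : ZMod d → EuclideanSpace ℂ (ZMod d) := fun k =>
    WithLp.toLp 2 fun a => (Real.sqrt d : ℂ)⁻¹ * stdAddChar (a * ((γ : ZMod d) * k + α)) with hu
  set v : ZMod d → EuclideanSpace ℂ (ZMod d) := fun k =>
    WithLp.toLp 2 fun b => if b.val % q = k.val then
      (Real.sqrt g : ℂ)⁻¹ * (z * stdAddChar (β * b)) else 0 with hv
  have hsq : ∀ n : ℕ, (Real.sqrt n : ℂ)⁻¹ * (Real.sqrt n : ℂ)⁻¹ = (n : ℂ)⁻¹ := fun n => by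
    rw [← mul_inv, ← Complex.ofReal_mul, Real.mul_self_sqrt (Nat.cast_nonneg n),
      Complex.ofReal_natCast]
  have hzz : (starRingEnd ℂ) z * z = 1 := by
    rw [mul_comm, Complex.mul_conj, Complex.normSq_eq_norm_sq, hz]; simp
  refine isMaximallyEntangled_of_schmidt (u := u) (v := v) ?_ ?_ ?_
  · rw [orthonormal_iff_ite]
    rintro ⟨k, hk⟩ ⟨l, hl⟩
    have hk : k.val < q := hk
    have hl : l.val < q := hl
    have hkl : (γ : ZMod d) * (l - k) = 0 ↔ k = l := by
      refine ⟨fun h => ?_, fun h => by rw [h]; simp⟩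
      have h1 : (((γ * ((l.val : ℤ) - k.val) : ℤ)) : ZMod d) = 0 := by
        push_cast
        rw [ZMod.natCast_zmod_val, ZMod.natCast_zmod_val, h]
      have h2 := hdvd _ ((ZMod.intCast_zmod_eq_zero_iff_dvd _ _).1 h1)
      have h3 : (l.val : ℤ) - k.val = 0 := Int.eq_zero_of_abs_lt_dvd h2 (by rw [abs_lt]; omega)
      exact ZMod.val_injective d (by omega)
    simp only [Set.domRestrict_apply, PiLp.inner_apply, RCLike.inner_apply, hu, map_mul,
      Subtype.mk.injEq]
    have h4 : ∀ a : ZMod d, (Real.sqrt d : ℂ)⁻¹ * stdAddChar (a * ((γ : ZMod d) * l + α)) *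
        ((starRingEnd ℂ) (Real.sqrt d : ℂ)⁻¹ * (starRingEnd ℂ) (stdAddChar (a * ((γ : ZMod d) * k + α)))) =
        (d : ℂ)⁻¹ * stdAddChar (a * ((γ : ZMod d) * (l - k))) := by
      intro a
      have : (stdAddChar (a * ((γ : ZMod d) * (l - k))) : ℂ) = stdAddChar (a * ((γ : ZMod d) * l + α)) *
          (starRingEnd ℂ) (stdAddChar (a * ((γ : ZMod d) * k + α))) := by
        rw [← AddChar.map_neg_eq_conj, ← AddChar.map_add_eq_mul]
        congr 1
        ring
      rw [this, ← hsq, map_inv₀, Complex.conj_ofReal]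
      ring
    rw [Finset.sum_congr rfl fun a _ => h4 a, ← Finset.mul_sum,
      AddChar.sum_mulShift _ (ZMod.isPrimitive_stdAddChar d)]
    by_cases h : k = l
    · simp [h, ZMod.card]
    · simp [h, hkl]
  · rw [orthonormal_iff_ite]
    rintro ⟨k, hk⟩ ⟨l, hl⟩
    have hk : k.val < q := hk
    simp only [Set.domRestrict_apply, PiLp.inner_apply, RCLike.inner_apply, hv, Subtype.mk.injEq]
    by_cases h : k = l
    · subst h
      have h5 : ∀ b : ZMod d, (if b.val % q = k.val then
            (Real.sqrt g : ℂ)⁻¹ * (z * stdAddChar (β * b)) else 0) *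
          (starRingEnd ℂ) (if b.val % q = k.val then
            (Real.sqrt g : ℂ)⁻¹ * (z * stdAddChar (β * b)) else 0) =
          if b.val % q = k.val then (g : ℂ)⁻¹ else 0 := by
        intro b
        split_ifs with hb
        · have : (stdAddChar (β * b) : ℂ) * (starRingEnd ℂ) (stdAddChar (β * b)) = 1 := by
            rw [← AddChar.map_neg_eq_conj, ← AddChar.map_add_eq_mul]; simp
          rw [RingHom.map_mul, RingHom.map_mul, map_inv₀, Complex.conj_ofReal, ← hsq]
          linear_combination (Real.sqrt g : ℂ)⁻¹ * (Real.sqrt g : ℂ)⁻¹ *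
            (((starRingEnd ℂ) z * z) * this + hzz)
        · simp
      rw [Finset.sum_congr rfl fun b _ => h5 b, ← Finset.sum_filter, Finset.sum_const,
        card_filter_val_mod hqg hk]
      simp [hgpos.ne']
    · rw [if_neg h]
      refine Finset.sum_eq_zero fun b _ => ?_
      by_cases hb : b.val % q = k.val
      · have : b.val % q ≠ l.val := fun h' => h (ZMod.val_injective d (hb.symm.trans h'))
        simp [this]
      · simp [hb]
  · rintro ⟨a, b⟩
    rw [hφ]
    -- Only the Schmidt vectors with index `k = b mod q` are supported at `b`.
    have hlt : b.val % q < q := Nat.mod_lt _ hqpos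
    have hkval : ((b.val % q : ℕ) : ZMod d).val = b.val % q :=
      ZMod.val_natCast_of_lt ((Nat.mod_le _ _).trans_lt (ZMod.val_lt b))
    rw [Finset.sum_eq_single ((b.val % q : ℕ) : ZMod d)]
    · simp only [hu, hv, hkval, if_true]
      have h6 : (stdAddChar ((γ : ZMod d) * a * b + α * a + β * b) : ℂ) =
          stdAddChar (a * ((γ : ZMod d) * ((b.val % q : ℕ) : ZMod d) + α)) * stdAddChar (β * b) := by
        rw [← AddChar.map_add_eq_mul, ← hperiod]
        congr 1
        ring
      have h7 : (Real.sqrt q : ℂ)⁻¹ * (Real.sqrt g : ℂ)⁻¹ = (Real.sqrt d : ℂ)⁻¹ := by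
        rw [← mul_inv, ← Complex.ofReal_mul, ← Real.sqrt_mul (Nat.cast_nonneg q), hqg]
        push_cast
        rfl
      rw [h6, div_eq_mul_inv, ← hsq]
      linear_combination (-z * (Real.sqrt d : ℂ)⁻¹ *
        stdAddChar (a * ((γ : ZMod d) * ((b.val % q : ℕ) : ZMod d) + α)) * stdAddChar (β * b)) * h7
    · intro k hk hkb
      have : b.val % q ≠ k.val := fun h => hkb (by rw [h, ZMod.natCast_zmod_val])
      simp [hv, this]
    · intro h
      exact absurd (Finset.mem_filter.2 ⟨Finset.mem_univ _, by rw [hkval]; exact hlt⟩) h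

theorem two_le_div_gcd [NeZero d] {γ : ℕ} (h : ¬ d ∣ γ) : 2 ≤ d / Nat.gcd d γ := by
  have hd0 : 0 < d := Nat.pos_of_ne_zero (NeZero.ne d)
  have h1 : 0 < d / Nat.gcd d γ :=
    Nat.div_pos (Nat.le_of_dvd hd0 (Nat.gcd_dvd_left d γ)) (Nat.gcd_pos_of_pos_left _ hd0)
  by_contra hlt
  have h2 : d / Nat.gcd d γ = 1 := by omega
  have h3 := Nat.div_mul_cancel (Nat.gcd_dvd_left d γ)
  rw [h2, one_mul] at h3
  exact h (h3 ▸ Nat.gcd_dvd_right d γ)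

section PostState

variable {β : Type*} {G : Graph (Fin N) β} [G.Loopless] {ψ : Space N d}

theorem IsGraphState.condVec_apply [NeZero d] (hψ : IsGraphState G ψ) {i j : Fin N} (hij : i ≠ j)
    (a : Fin N → ZMod d) : ∃ c : ℂ, c ≠ 0 ∧ ∀ p, condVec ψ i j a p = c * stdAddChar
      ((edgeMult G i j : ZMod d) * p.1 * p.2 + (outcomePhase G i j a : ZMod d) * p.1 +
        (outcomePhase G j i a : ZMod d) * p.2) := by
  refine ⟨_, mul_ne_zero hψ.apply_zero_ne_zero (stdAddChar_ne_zero (graphPhase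
    (fun i j => (edgeMult G i j : ZMod d)) (Function.update (Function.update a i 0) j 0))),
    fun p => ?_⟩
  simp only [condVec]
  rw [hψ.apply_eq, graphPhase_update_update (fun i j => by rw [edgeMult_comm G i j])
    (fun i => by simp [edgeMult_self]) a hij, mul_assoc (ψ 0), ← AddChar.map_add_eq_mul]
  have h1 : (outcomePhase G i j a : ZMod d) =
      ∑ l with l ≠ i ∧ l ≠ j, (edgeMult G i l : ZMod d) * a l := by
    simp [outcomePhase]
  have h2 : (outcomePhase G j i a : ZMod d) =
      ∑ l with l ≠ i ∧ l ≠ j, (edgeMult G j l : ZMod d) * a l := by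
    simp [outcomePhase, and_comm]
  rw [h1, h2]
  congr 2
  ring

theorem IsGraphState.condVec_ne_zero [NeZero d] (hψ : IsGraphState G ψ) {i j : Fin N} (hij : i ≠ j)
    (a : Fin N → ZMod d) : condVec ψ i j a ≠ 0 := by
  obtain ⟨c, hc, h⟩ := hψ.condVec_apply hij a
  intro h0
  have := h (0, 0)
  rw [h0] at this
  exact mul_ne_zero hc (stdAddChar_ne_zero _) this.symm

theorem IsGraphState.norm_postState [NeZero d] (hψ : IsGraphState G ψ) {i j : Fin N} (hij : i ≠ j)
    (a : Fin N → ZMod d) : ‖postState ψ i j a‖ = 1 := by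
  rw [postState, norm_smul, Complex.norm_real, norm_inv, norm_norm,
    inv_mul_cancel₀ (norm_ne_zero_iff.2 (hψ.condVec_ne_zero hij a))]

/-- The amplitudes of a post-measurement state all have modulus `1 / d`. -/
theorem IsGraphState.postState_apply [NeZero d] (hψ : IsGraphState G ψ) {i j : Fin N} (hij : i ≠ j)
    (a : Fin N → ZMod d) : ∃ z : ℂ, ‖z‖ = 1 ∧ ∀ p, postState ψ i j a p = z / d * stdAddChar
      ((edgeMult G i j : ZMod d) * p.1 * p.2 + (outcomePhase G i j a : ZMod d) * p.1 +
        (outcomePhase G j i a : ZMod d) * p.2) := by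
  obtain ⟨c, -, h⟩ := hψ.condVec_apply hij a
  have hd : (d : ℂ) ≠ 0 := Nat.cast_ne_zero.2 (NeZero.ne d)
  set t : ℂ := ((‖condVec ψ i j a‖⁻¹ : ℝ) : ℂ) * c with ht
  have hp : ∀ p, postState ψ i j a p = t * stdAddChar
      ((edgeMult G i j : ZMod d) * p.1 * p.2 + (outcomePhase G i j a : ZMod d) * p.1 +
        (outcomePhase G j i a : ZMod d) * p.2) := fun p => by
    rw [postState, PiLp.smul_apply, h, smul_eq_mul, ht, ← mul_assoc]
  refine ⟨t * d, ?_, fun p => by rw [hp, mul_div_cancel_right₀ _ hd]⟩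
  have hn := hψ.norm_postState hij a
  rw [EuclideanSpace.norm_eq, Real.sqrt_eq_one] at hn
  simp only [hp, norm_mul, ZMod.stdAddChar_apply, Circle.norm_coe, mul_one, Finset.sum_const,
    Finset.card_univ, Fintype.card_prod, ZMod.card, nsmul_eq_mul] at hn
  rw [norm_mul, Complex.norm_natCast]
  have : (‖t‖ * d) ^ 2 = 1 := by rw [← hn]; push_cast; ring
  exact (pow_eq_one_iff_of_nonneg (by positivity) two_ne_zero).1 this

theorem IsGraphState.isPairStabilized [NeZero d] (hψ : IsGraphState G ψ) {i j : Fin N}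
    (hij : i ≠ j) (a : Fin N → ZMod d) :
    IsPairStabilized (edgeMult G i j) (outcomePhase G i j a) (outcomePhase G j i a)
      (postState ψ i j a) := by
  obtain ⟨z, -, h⟩ := hψ.postState_apply hij a
  exact isPairStabilized_iff.2 ⟨_, h⟩

theorem IsGraphState.eq_smul_postState [NeZero d] (hψ : IsGraphState G ψ) {i j : Fin N}
    (hij : i ≠ j) (a : Fin N → ZMod d) {φ : PairSpace d}
    (hφ : IsPairStabilized (edgeMult G i j) (outcomePhase G i j a) (outcomePhase G j i a) φ) :
    ∃ c : ℂ, φ = c • postState ψ i j a := by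
  obtain ⟨z, hz, h⟩ := hψ.postState_apply hij a
  obtain ⟨c, hc⟩ := isPairStabilized_iff.1 hφ
  have hd : (d : ℂ) ≠ 0 := Nat.cast_ne_zero.2 (NeZero.ne d)
  have hz0 : z ≠ 0 := by rintro rfl; simp at hz
  refine ⟨c * (d / z), ?_⟩
  ext p
  rw [PiLp.smul_apply, h, hc, smul_eq_mul]
  field_simp

theorem IsGraphState.isMaximallyEntangled [NeZero d] (hψ : IsGraphState G ψ) {i j : Fin N}
    (hij : i ≠ j) (a : Fin N → ZMod d) :
    IsMaximallyEntangled (d / Nat.gcd d (edgeMult G i j)) (postState ψ i j a) := by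
  obtain ⟨z, hz, h⟩ := hψ.postState_apply hij a
  exact isMaximallyEntangled_of_apply_eq hz _ _ h

end PostState

/-! ### The chained inequality for local behaviors -/

section Chain

variable {K : Type*} [Fintype K] [DecidableEq K]

/-- The total weight that a table `p` puts on the pairs `(α, β)` violating `α = σ β`. -/
def mismatch (σ : K → K) (p : K → K → ℝ) : ℝ := ∑ α, ∑ β, if α = σ β then 0 else p α β

/-- The chained Bell expression: `p k l` is the joint distribution of the outcomes of the `k`-th
measurement of one party and the `l`-th of the other. The outcomes are compared along the chain
`A₀, B₀, A₁, B₁, …, Aₙ, Bₙ`, and the ends `A₀` and `Bₙ` are tested for `α = σ β`. -/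
def chainSum (σ : K → K) (n : ℕ) (p : ℕ → ℕ → K → K → ℝ) : ℝ :=
  ∑ k ∈ Finset.range (n + 1), mismatch id (p k k) +
    ∑ k ∈ Finset.range n, mismatch id (p (k + 1) k) + mismatch σ (p 0 n)

theorem mismatch_mono {σ : K → K} {p p' : K → K → ℝ} (h : ∀ α β, p α β ≤ p' α β) :
    mismatch σ p ≤ mismatch σ p' := by
  refine Finset.sum_le_sum fun α _ => Finset.sum_le_sum fun β _ => ?_
  split_ifs
  · exact le_rfl
  · exact h α β

theorem chainSum_mono {σ : K → K} {n : ℕ} {p p' : ℕ → ℕ → K → K → ℝ}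
    (h : ∀ k l α β, p k l α β ≤ p' k l α β) : chainSum σ n p ≤ chainSum σ n p' :=
  add_le_add (add_le_add (Finset.sum_le_sum fun _ _ => mismatch_mono (h _ _))
    (Finset.sum_le_sum fun _ _ => mismatch_mono (h _ _))) (mismatch_mono (h _ _))

theorem mismatch_const_mul (σ : K → K) (w : ℝ) (p : K → K → ℝ) :
    mismatch σ (fun α β => w * p α β) = w * mismatch σ p := by
  simp only [mismatch, Finset.mul_sum, mul_ite, mul_zero]

theorem chainSum_const_mul (σ : K → K) (n : ℕ) (w : ℝ) (p : ℕ → ℕ → K → K → ℝ) :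
    chainSum σ n (fun k l α β => w * p k l α β) = w * chainSum σ n p := by
  simp only [chainSum, mismatch_const_mul, mul_add, Finset.mul_sum]

/-- For independent `f, f', g, g'`, whenever `f ≠ g'` one of `f ≠ g`, `f' ≠ g`, `f' ≠ g'` holds. -/
theorem mismatch_mul_triangle {f f' g g' : K → ℝ} {F G : ℝ} (hf : ∀ α, 0 ≤ f α)
    (hf' : ∀ α, 0 ≤ f' α) (hg : ∀ β, 0 ≤ g β) (hg' : ∀ β, 0 ≤ g' β) (sf : ∑ α, f α = F)
    (sf' : ∑ α, f' α = F) (sg : ∑ β, g β = G) (sg' : ∑ β, g' β = G) :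
    mismatch id (fun α β => f α * g' β) ≤ mismatch id (fun α β => f α * g β) +
      mismatch id (fun α β => f' α * g β) + mismatch id (fun α β => f' α * g' β) := by
  have nonneg : ∀ {u v : K → ℝ}, (∀ α, 0 ≤ u α) → (∀ α, 0 ≤ v α) →
      0 ≤ mismatch id (fun α β => u α * v β) := fun hu hv =>
    Finset.sum_nonneg fun α _ => Finset.sum_nonneg fun β _ => by
      split_ifs
      · exact le_rfl
      · exact mul_nonneg (hu _) (hv _)
  have hF : 0 ≤ F := sf ▸ Finset.sum_nonneg fun α _ => hf α
  have hG : 0 ≤ G := sg ▸ Finset.sum_nonneg fun α _ => hg α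
  have hrest := add_nonneg (add_nonneg (nonneg hf hg) (nonneg hf' hg)) (nonneg hf' hg')
  rcases hF.eq_or_lt with h0 | hFpos
  · have : ∀ α, f α = 0 := fun α =>
      (Finset.sum_eq_zero_iff_of_nonneg fun α _ => hf α).1 (sf.trans h0.symm) α (Finset.mem_univ α)
    refine le_trans (le_of_eq ?_) hrest
    simp [mismatch, this]
  rcases hG.eq_or_lt with h0 | hGpos
  · have : ∀ β, g' β = 0 := fun α =>
      (Finset.sum_eq_zero_iff_of_nonneg fun α _ => hg' α).1 (sg'.trans h0.symm) α
        (Finset.mem_univ α)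
    refine le_trans (le_of_eq ?_) hrest
    simp [mismatch, this]
  -- Write every term as a sum over the joint outcomes of all four variables.
  set J : K → K → K → K → ℝ := fun α α' β β' => f α * f' α' * g β * g' β' with hJ
  have hJ0 : ∀ α α' β β', 0 ≤ J α α' β β' := fun α α' β β' =>
    mul_nonneg (mul_nonneg (mul_nonneg (hf _) (hf' _)) (hg _)) (hg' _)
  have e1 : mismatch id (fun α β => f α * g' β) * (F * G) =
      ∑ α, ∑ α', ∑ β, ∑ β', if α = β' then 0 else J α α' β β' := by
    rw [← sf', ← sg, mismatch, Finset.sum_mul]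
    refine Finset.sum_congr rfl fun α _ => ?_
    rw [Finset.sum_mul_sum, Finset.mul_sum]
    refine Finset.sum_congr rfl fun α' _ => ?_
    rw [Finset.mul_sum]
    refine Finset.sum_congr rfl fun β _ => ?_
    rw [Finset.sum_mul]
    refine Finset.sum_congr rfl fun β' _ => ?_
    simp only [id, hJ]
    split_ifs <;> ring
  have e2 : mismatch id (fun α β => f α * g β) * (F * G) =
      ∑ α, ∑ α', ∑ β, ∑ β', if α = β then 0 else J α α' β β' := by
    rw [← sf', ← sg', mismatch, Finset.sum_mul]
    refine Finset.sum_congr rfl fun α _ => ?_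
    rw [Finset.sum_mul_sum, Finset.mul_sum]
    refine Finset.sum_congr rfl fun α' _ => ?_
    rw [← Finset.mul_sum, Finset.sum_mul]
    refine Finset.sum_congr rfl fun β _ => ?_
    rw [Finset.mul_sum, Finset.mul_sum]
    refine Finset.sum_congr rfl fun β' _ => ?_
    simp only [id, hJ]
    split_ifs <;> ring
  have e3 : mismatch id (fun α β => f' α * g β) * (F * G) =
      ∑ α, ∑ α', ∑ β, ∑ β', if α' = β then 0 else J α α' β β' := by
    rw [← sf, ← sg', mismatch, mul_comm, mul_assoc, Finset.sum_mul]
    refine Finset.sum_congr rfl fun α _ => ?_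
    rw [Finset.mul_sum, Finset.mul_sum]
    refine Finset.sum_congr rfl fun α' _ => ?_
    rw [Finset.mul_sum, Finset.mul_sum]
    refine Finset.sum_congr rfl fun β _ => ?_
    rw [Finset.sum_mul, Finset.mul_sum]
    refine Finset.sum_congr rfl fun β' _ => ?_
    simp only [id, hJ]
    split_ifs <;> ring
  have e4 : mismatch id (fun α β => f' α * g' β) * (F * G) =
      ∑ α, ∑ α', ∑ β, ∑ β', if α' = β' then 0 else J α α' β β' := by
    rw [← sf, ← sg, mismatch, mul_comm, mul_assoc, Finset.sum_mul]
    refine Finset.sum_congr rfl fun α _ => ?_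
    rw [Finset.mul_sum, Finset.mul_sum]
    refine Finset.sum_congr rfl fun α' _ => ?_
    rw [Finset.sum_mul, Finset.mul_sum]
    refine Finset.sum_congr rfl fun β _ => ?_
    rw [Finset.mul_sum, Finset.mul_sum]
    refine Finset.sum_congr rfl fun β' _ => ?_
    simp only [id, hJ]
    split_ifs <;> ring
  refine le_of_mul_le_mul_right ?_ (mul_pos hFpos hGpos)
  rw [add_mul, add_mul, e1, e2, e3, e4]
  simp only [← Finset.sum_add_distrib]
  refine Finset.sum_le_sum fun α _ => Finset.sum_le_sum fun α' _ =>
    Finset.sum_le_sum fun β _ => Finset.sum_le_sum fun β' _ => ?_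
  have hJ := hJ0 α α' β β'
  generalize J α α' β β' = c at hJ
  have nn : ∀ (P : Prop) [Decidable P], 0 ≤ if P then 0 else c := fun P _ => by
    split_ifs <;> simp [hJ]
  have n1 := nn (α = β)
  have n2 := nn (α' = β)
  have n3 := nn (α' = β')
  by_cases h1 : α = β'
  · rw [if_pos h1]; linarith
  · rw [if_neg h1]
    by_cases h2 : α = β
    · by_cases h3 : α' = β
      · rw [if_neg (show α' ≠ β' from fun h => h1 (h2.trans (h3.symm.trans h)))]
        linarith
      · rw [if_neg h3]; linarith
    · rw [if_neg h2]; linarith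

end Chain

section LocalChain

variable {K : Type*} [Fintype K] [DecidableEq K]

/-- The chained inequality for independent outcomes: if `α = β` held all along the chain, then
both `α = β` and `α = σ β` would hold for its ends, which is impossible as `σ` has no fixed
point. -/
theorem mul_le_chainSum {σ : K → K} (hσ : ∀ β, σ β ≠ β) {f g : ℕ → K → ℝ} {F G : ℝ}
    (hf : ∀ k α, 0 ≤ f k α) (hg : ∀ k β, 0 ≤ g k β) (sf : ∀ k, ∑ α, f k α = F)
    (sg : ∀ k, ∑ β, g k β = G) (n : ℕ) :
    F * G ≤ chainSum σ n fun k l α β => f k α * g l β := by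
  have chain : ∀ n, mismatch id (fun α β => f 0 α * g n β) ≤
      ∑ k ∈ Finset.range (n + 1), mismatch id (fun α β => f k α * g k β) +
        ∑ k ∈ Finset.range n, mismatch id (fun α β => f (k + 1) α * g k β) := by
    intro n
    induction n with
    | zero => simp
    | succ n ih =>
      have := mismatch_mul_triangle (hf 0) (hf (n + 1)) (hg n) (hg (n + 1)) (sf 0) (sf (n + 1))
        (sg n) (sg (n + 1))
      rw [Finset.sum_range_succ _ (n + 1),
        Finset.sum_range_succ (fun k => mismatch id fun α β => f (k + 1) α * g k β) n]
      linarith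
  have ends : F * G ≤ mismatch id (fun α β => f 0 α * g n β) +
      mismatch σ (fun α β => f 0 α * g n β) := by
    rw [← sf 0, ← sg n, Finset.sum_mul_sum, mismatch, mismatch, ← Finset.sum_add_distrib]
    refine Finset.sum_le_sum fun α _ => ?_
    rw [← Finset.sum_add_distrib]
    refine Finset.sum_le_sum fun β _ => ?_
    have h0 := mul_nonneg (hf 0 α) (hg n β)
    by_cases h : α = β
    · rw [if_neg (show α ≠ σ β from fun h' => hσ β (h'.symm.trans h))]
      split_ifs <;> linarith
    · rw [if_neg (show α ≠ id β from h)]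
      split_ifs <;> linarith
  exact ends.trans (add_le_add_left (chain n) _)

open MeasureTheory in
theorem integrable_mismatch {Λ : Type*} [MeasurableSpace Λ] {μ : Measure Λ} (σ : K → K)
    {h : Λ → K → K → ℝ} (hh : ∀ α β, Integrable (fun lam => h lam α β) μ) :
    Integrable (fun lam => mismatch σ (h lam)) μ := by
  refine integrable_finsetSum _ fun α _ => integrable_finsetSum _ fun β _ => ?_
  split_ifs
  · exact integrable_zero _ _ _
  · exact hh α β

open MeasureTheory in
theorem integral_mismatch {Λ : Type*} [MeasurableSpace Λ] {μ : Measure Λ} (σ : K → K)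
    {h : Λ → K → K → ℝ} (hh : ∀ α β, Integrable (fun lam => h lam α β) μ) :
    mismatch σ (fun α β => ∫ lam, h lam α β ∂μ) = ∫ lam, mismatch σ (h lam) ∂μ := by
  have hint : ∀ α β, Integrable (fun lam => if α = σ β then 0 else h lam α β) μ := by
    intro α β
    split_ifs
    · exact integrable_zero _ _ _
    · exact hh α β
  simp only [mismatch]
  rw [integral_finsetSum _ fun α _ => integrable_finsetSum _ fun β _ => hint α β]
  refine Finset.sum_congr rfl fun α _ => ?_
  rw [integral_finsetSum _ fun β _ => hint α β]
  refine Finset.sum_congr rfl fun β _ => ?_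
  split_ifs <;> simp

open MeasureTheory in
theorem integrable_chainSum {Λ : Type*} [MeasurableSpace Λ] {μ : Measure Λ} (σ : K → K) (n : ℕ)
    {h : Λ → ℕ → ℕ → K → K → ℝ} (hh : ∀ k l α β, Integrable (fun lam => h lam k l α β) μ) :
    Integrable (fun lam => chainSum σ n (h lam)) μ :=
  ((integrable_finsetSum _ fun k _ => integrable_mismatch _ (hh k k)).add
    (integrable_finsetSum _ fun k _ => integrable_mismatch _ (hh (k + 1) k))).add
    (integrable_mismatch _ (hh 0 n))

open MeasureTheory in
theorem integral_chainSum {Λ : Type*} [MeasurableSpace Λ] {μ : Measure Λ} (σ : K → K) (n : ℕ)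
    {h : Λ → ℕ → ℕ → K → K → ℝ} (hh : ∀ k l α β, Integrable (fun lam => h lam k l α β) μ) :
    chainSum σ n (fun k l α β => ∫ lam, h lam k l α β ∂μ) = ∫ lam, chainSum σ n (h lam) ∂μ := by
  have i1 : ∀ k ∈ Finset.range (n + 1), Integrable (fun lam => mismatch id (h lam k k)) μ :=
    fun k _ => integrable_mismatch _ (hh k k)
  have i2 : ∀ k ∈ Finset.range n, Integrable (fun lam => mismatch id (h lam (k + 1) k)) μ :=
    fun k _ => integrable_mismatch _ (hh (k + 1) k)
  have i3 := integrable_mismatch σ (hh 0 n)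
  simp only [chainSum]
  have i12 : Integrable (fun lam => ∑ k ∈ Finset.range (n + 1), mismatch id (h lam k k) +
      ∑ k ∈ Finset.range n, mismatch id (h lam (k + 1) k)) μ :=
    (integrable_finsetSum _ i1).add (integrable_finsetSum _ i2)
  rw [integral_add i12 i3, integral_add (integrable_finsetSum _ i1) (integrable_finsetSum _ i2),
    integral_finsetSum _ i1, integral_finsetSum _ i2]
  simp only [← integral_mismatch _ (hh _ _)]

end LocalChain

section Local

variable {X K : Type*} [Fintype K]

theorem IsBehavior.le_one {ι : Type*} [Fintype ι] [DecidableEq ι] {P : Behavior ι X K}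
    (hP : IsBehavior P) (x : ι → X) (a : ι → K) : P x a ≤ 1 := by
  rw [← hP.2 x]
  exact Finset.single_le_sum (fun b _ => hP.1 x b) (Finset.mem_univ a)

theorem sum_restrict_mul_restrict (Q : Finset (Fin N)) (f : (Q → K) → ℝ)
    (g : ((Qᶜ : Finset (Fin N)) → K) → ℝ) :
    ∑ a : Fin N → K, f (Q.restrict a) * g (Qᶜ.restrict a) = (∑ u, f u) * ∑ v, g v := by
  rw [Finset.sum_mul_sum, ← Fintype.sum_prod_type']
  refine Fintype.sum_bijective (fun a => (Q.restrict a, Qᶜ.restrict a)) ⟨?_, ?_⟩ _ _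
    (fun _ => rfl)
  · intro a b hab
    rw [Prod.mk.injEq] at hab
    ext l
    by_cases hl : l ∈ Q
    · exact congrFun hab.1 ⟨l, hl⟩
    · exact congrFun hab.2 ⟨l, Finset.mem_compl.2 hl⟩
  · rintro ⟨u, v⟩
    refine ⟨fun l => if h : l ∈ Q then u ⟨l, h⟩ else v ⟨l, Finset.mem_compl.2 h⟩, ?_⟩
    rw [Prod.mk.injEq]
    constructor
    · ext ⟨l, hl⟩
      simp [Finset.restrict, hl]
    · ext ⟨l, hl⟩
      simp [Finset.restrict, Finset.mem_compl.1 hl]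

variable [DecidableEq K]

theorem IsNonSignaling.sum_update_eq {ι : Type*} [Fintype ι] [DecidableEq ι]
    {P : Behavior ι X K} (hP : IsNonSignaling P) (x : ι → X) (i : ι) (s : X) (a : ι → K) :
    ∑ α, P (Function.update x i s) (Function.update a i α) =
      ∑ α, P x (Function.update a i α) := by
  have key : ∀ y, ∑ b with ∀ l ∈ Finset.univ.erase i, b l = a l, P y b =
      ∑ α, P y (Function.update a i α) := by
    intro y
    symm
    refine Finset.sum_bij (fun α _ => Function.update a i α) ?_ ?_ ?_ (fun _ _ => rfl)
    · intro α _
      simp +contextual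
    · intro α _ β _ h
      simpa using congrFun h i
    · intro b hb
      refine ⟨b i, Finset.mem_univ _, ?_⟩
      ext l
      by_cases hl : l = i
      · subst hl; simp
      · simpa [hl] using ((Finset.mem_filter.1 hb).2 l (by simp [hl])).symm
  rw [← key, ← key]
  exact hP.2 _ _ _ (fun l hl => by simp [Finset.ne_of_mem_erase hl]) a

theorem restrict_update_of_mem {N : ℕ} {Y : Type*} {Q : Finset (Fin N)} {i : Fin N} (hi : i ∈ Q)
    (x : Fin N → Y) (s : Y) :
    Q.restrict (Function.update x i s) = Function.update (Q.restrict x) ⟨i, hi⟩ s := by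
  ext ⟨l, hl⟩
  by_cases h : l = i
  · subst h; simp [Finset.restrict]
  · simp [Finset.restrict, h, Function.update_of_ne, Subtype.ext_iff]

theorem restrict_update_of_notMem {N : ℕ} {Y : Type*} {Q : Finset (Fin N)} {i : Fin N}
    (hi : i ∉ Q) (x : Fin N → Y) (s : Y) :
    Q.restrict (Function.update x i s) = Q.restrict x := by
  ext ⟨l, hl⟩
  have : l ≠ i := fun h => hi (h ▸ hl)
  simp [Finset.restrict, this]

open MeasureTheory in
theorem integrable_mul_of_isNonSignaling {ι κ Λ : Type*} [Fintype ι] [DecidableEq ι] [Fintype κ]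
    [DecidableEq κ] [MeasurableSpace Λ] {μ : Measure Λ} [IsProbabilityMeasure μ]
    {PQ : Λ → Behavior ι X K} {PR : Λ → Behavior κ X K}
    (nQ : ∀ lam, IsNonSignaling (PQ lam)) (nR : ∀ lam, IsNonSignaling (PR lam))
    (mQ : ∀ x a, Measurable fun lam => PQ lam x a) (mR : ∀ x a, Measurable fun lam => PR lam x a)
    (x : ι → X) (a : ι → K) (y : κ → X) (b : κ → K) :
    Integrable (fun lam => PQ lam x a * PR lam y b) μ := by
  refine Integrable.of_bound ((mQ x a).mul (mR y b)).aestronglyMeasurable 1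
    (Filter.Eventually.of_forall fun lam => ?_)
  have h1 := (nQ lam).1.1 x a
  have h2 := (nR lam).1.1 y b
  rw [Real.norm_of_nonneg (mul_nonneg h1 h2)]
  exact mul_le_one₀ ((nQ lam).1.le_one x a) h2 ((nR lam).1.le_one y b)

theorem IsLocalAcross.nonneg {Q : Finset (Fin N)} {P : Behavior (Fin N) X K}
    (hP : IsLocalAcross Q P) (x : Fin N → X) (a : Fin N → K) : 0 ≤ P x a := by
  obtain ⟨Λ, _, μ, PQ, PR, _, nQ, nR, mQ, mR, hP⟩ := hP
  rw [hP]
  exact MeasureTheory.integral_nonneg fun lam =>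
    mul_nonneg ((nQ lam).1.1 _ _) ((nR lam).1.1 _ _)

theorem IsLocalAcross.sum_eq_one {Q : Finset (Fin N)} {P : Behavior (Fin N) X K}
    (hP : IsLocalAcross Q P) (x : Fin N → X) : ∑ a, P x a = 1 := by
  obtain ⟨Λ, _, μ, PQ, PR, hμ, nQ, nR, mQ, mR, hP⟩ := hP
  simp only [hP]
  rw [← MeasureTheory.integral_finsetSum _ fun a _ =>
    integrable_mul_of_isNonSignaling nQ nR mQ mR _ _ _ _]
  have : ∀ lam, ∑ a : Fin N → K, PQ lam (Q.restrict x) (Q.restrict a) *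
      PR lam (Qᶜ.restrict x) (Qᶜ.restrict a) = 1 := fun lam => by
    rw [sum_restrict_mul_restrict Q (PQ lam (Q.restrict x)) (PR lam (Qᶜ.restrict x)),
      (nQ lam).1.2, (nR lam).1.2, one_mul]
  simp [this]

/-- A behavior that is local across a cut separating `i` from `j` obeys the chained inequality for
the outcomes of `i` and `j`, jointly with any outcome `a` of the other parties: as both factors are
non-signaling, the probability of `a` on each side does not depend on the settings of `i`, `j`. -/
theorem IsLocalAcross.le_chainSum {Q : Finset (Fin N)} {P : Behavior (Fin N) X K}
    (hP : IsLocalAcross Q P) {i j : Fin N} (hi : i ∈ Q) (hj : j ∈ Qᶜ) {σ : K → K}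
    (hσ : ∀ β, σ β ≠ β) (x : Fin N → X) (a : Fin N → K) (A B : ℕ → X) (n : ℕ) :
    P x a ≤ chainSum σ n fun k l α β =>
      P (Function.update (Function.update x i (A k)) j (B l))
        (Function.update (Function.update a i α) j β) := by
  obtain ⟨Λ, _, μ, PQ, PR, hμ, nQ, nR, mQ, mR, hP⟩ := hP
  have hjQ : j ∉ Q := Finset.mem_compl.1 hj
  have hiR : i ∉ Qᶜ := fun h => Finset.mem_compl.1 h hi
  have hint := fun x a y b => integrable_mul_of_isNonSignaling (μ := μ) nQ nR mQ mR x a y b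
  simp only [hP, restrict_update_of_notMem hjQ, restrict_update_of_mem hi,
    restrict_update_of_mem hj, restrict_update_of_notMem hiR]
  rw [integral_chainSum σ n fun k l α β => hint _ _ _ _]
  refine MeasureTheory.integral_mono (hint _ _ _ _)
    (integrable_chainSum σ n fun k l α β => hint _ _ _ _) fun lam => ?_
  have sQ := fun k => (nQ lam).sum_update_eq (Q.restrict x) ⟨i, hi⟩ (A k) (Q.restrict a)
  have sR := fun k => (nR lam).sum_update_eq (Qᶜ.restrict x) ⟨j, hj⟩ (B k) (Qᶜ.restrict a)
  refine le_trans ?_ (mul_le_chainSum hσ (fun k α => (nQ lam).1.1 _ _)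
    (fun k β => (nR lam).1.1 _ _) sQ sR n)
  refine mul_le_mul ?_ ?_ ((nR lam).1.1 _ _) (Finset.sum_nonneg fun _ _ => (nQ lam).1.1 _ _)
  · have := Finset.single_le_sum (f := fun α => PQ lam (Q.restrict x)
      (Function.update (Q.restrict a) ⟨i, hi⟩ α)) (fun _ _ => (nQ lam).1.1 _ _)
      (Finset.mem_univ (a i))
    refine le_trans (le_of_eq ?_) this
    simp only
    rw [show a i = Q.restrict a ⟨i, hi⟩ from rfl, Function.update_eq_self]
  · have := Finset.single_le_sum (f := fun α => PR lam (Qᶜ.restrict x)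
      (Function.update (Qᶜ.restrict a) ⟨j, hj⟩ α)) (fun _ _ => (nR lam).1.1 _ _)
      (Finset.mem_univ (a j))
    refine le_trans (le_of_eq ?_) this
    simp only
    rw [show a j = Qᶜ.restrict a ⟨j, hj⟩ from rfl, Function.update_eq_self]

/-! ### Bounding the nonlocality content -/

/-- `P` has chained expressions of at most `δ` across `Q | Qᶜ`: for some `i ∈ Q` and `j ∉ Q`, and for
every outcome `a` of the other parties at a fixed setting `x`, some chain of settings of `i` and
`j` makes the joint chained expression at most `δ` (the values of `a` and `x` at `i`, `j` are
overwritten). -/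
def IsChainedAcross (δ : ℝ) (Q : Finset (Fin N)) (P : Behavior (Fin N) X K) : Prop :=
  ∃ i ∈ Q, ∃ j ∈ Qᶜ, ∃ σ : K → K, (∀ β, σ β ≠ β) ∧ ∃ x : Fin N → X, ∀ a : Fin N → K,
    ∃ (A B : ℕ → X) (n : ℕ), (chainSum σ n fun k l α β =>
      P (Function.update (Function.update x i (A k)) j (B l))
        (Function.update (Function.update a i α) j β)) ≤ δ

/-- The weight of a local part is at most `δ` for each outcome of the other parties. Since the
settings may depend on that outcome, no outcome can hide the weight. -/
theorem IsChainedAcross.weight_le {δ : ℝ} {Q : Finset (Fin N)} {P PL : Behavior (Fin N) X K}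
    (hP : IsChainedAcross δ Q P) (hL : IsLocalAcross Q PL) {w : ℝ} (hw : 0 ≤ w)
    (hle : ∀ x a, w * PL x a ≤ P x a) : w ≤ Fintype.card (Fin N → K) * δ := by
  obtain ⟨i, hi, j, hj, σ, hσ, x, h⟩ := hP
  have key : ∀ a, w * PL x a ≤ δ := by
    intro a
    obtain ⟨A, B, n, hAB⟩ := h a
    refine le_trans ?_ hAB
    refine le_trans (mul_le_mul_of_nonneg_left (hL.le_chainSum hi hj hσ x a A B n) hw) ?_
    rw [← chainSum_const_mul]
    exact chainSum_mono fun k l α β => hle _ _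
  calc w = ∑ a, w * PL x a := by rw [← Finset.mul_sum, hL.sum_eq_one, mul_one]
    _ ≤ ∑ _a : Fin N → K, δ := Finset.sum_le_sum fun a _ => key a
    _ = Fintype.card (Fin N → K) * δ := by simp

theorem HasDecomposition.one_sub_le {P : Behavior (Fin N) X K} {p δ : ℝ}
    (hp : HasDecomposition P p) (hP : ∀ Q ∈ bipartitions N, IsChainedAcross δ Q P) :
    1 - (bipartitions N).card * (Fintype.card (Fin N → K) * δ) ≤ p := by
  obtain ⟨w, PL, PNL, hw, hp0, hsum, hL, hNL, -, hdec⟩ := hp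
  have : ∑ Q ∈ bipartitions N, w Q ≤
      ∑ _Q ∈ bipartitions N, (Fintype.card (Fin N → K) * δ) := by
    refine Finset.sum_le_sum fun Q hQ => (hP Q hQ).weight_le (hL Q hQ) (hw Q hQ) fun x a => ?_
    rw [hdec]
    have h1 := Finset.single_le_sum (f := fun Q => w Q * PL Q x a)
      (fun R hR => mul_nonneg (hw R hR) ((hL R hR).nonneg x a)) hQ
    have h2 := mul_nonneg hp0 (hNL.1 x a)
    linarith
  rw [Finset.sum_const, nsmul_eq_mul] at this
  linarith

theorem exists_isNonSignaling {ι : Type*} [Fintype ι] [DecidableEq ι] [Nonempty K] :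
    ∃ P : Behavior ι X K, IsNonSignaling P := by
  classical
  obtain ⟨k⟩ := ‹Nonempty K›
  refine ⟨fun _ a => if a = fun _ => k then 1 else 0, ⟨fun x a => ?_, fun x => by simp⟩,
    fun S x x' _ a => rfl⟩
  simp only
  split_ifs <;> simp

theorem exists_isLocalAcross [Nonempty K] (Q : Finset (Fin N)) :
    ∃ P : Behavior (Fin N) X K, IsLocalAcross Q P := by
  obtain ⟨P, hP⟩ := exists_isNonSignaling (X := X) (K := K) (ι := Q)
  obtain ⟨P', hP'⟩ := exists_isNonSignaling (X := X) (K := K) (ι := (Qᶜ : Finset (Fin N)))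
  exact ⟨_, Unit, inferInstance, MeasureTheory.Measure.dirac (), fun _ => P, fun _ => P',
    inferInstance, fun _ => hP, fun _ => hP', fun _ _ => measurable_const,
    fun _ _ => measurable_const, fun x a => rfl⟩

/-- A behavior of which every decomposition has a nonlocal part is nonlocal across every
bipartition, so that it is a decomposition of itself with nonlocal weight `1`. -/
theorem hasDecomposition_one [Nonempty K] {P : Behavior (Fin N) X K} (hP : IsBehavior P)
    (h : ∀ p, HasDecomposition P p → 0 < p) : HasDecomposition P 1 := by
  classical
  choose PL hPL using fun Q : Finset (Fin N) => exists_isLocalAcross (X := X) (K := K) Q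
  refine ⟨fun _ => 0, PL, P, fun _ _ => le_rfl, zero_le_one, by simp, fun Q _ => hPL Q, hP,
    fun _ Q hQ hloc => ?_, by simp⟩
  refine lt_irrefl 0 (h 0 ⟨fun R => if R = Q then 1 else 0, fun R => if R = Q then P else PL R, P,
    fun R _ => ?_, le_rfl, ?_, fun R _ => ?_, hP, fun h0 => absurd rfl h0, fun x a => ?_⟩)
  · simp only
    split_ifs <;> simp
  · simp [hQ]
  · simp only
    split_ifs with hR
    · rwa [hR]
    · exact hPL R
  · simp [hQ]

theorem nonlocalityContent_le_one [Nonempty K] {P : Behavior (Fin N) X K} (hP : IsBehavior P)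
    (h : ∀ p, HasDecomposition P p → 0 < p) : nonlocalityContent P ≤ 1 :=
  csInf_le ⟨0, fun p hp => (h p hp).le⟩ (hasDecomposition_one hP h)

theorem le_nonlocalityContent [Nonempty K] {P : Behavior (Fin N) X K} (hP : IsBehavior P) {c : ℝ}
    (hc : 0 < c) (h : ∀ p, HasDecomposition P p → c ≤ p) : c ≤ nonlocalityContent P :=
  le_csInf ⟨1, hasDecomposition_one hP fun p hp => hc.trans_le (h p hp)⟩ h

end Local

/-! ### Chained measurements on a maximally entangled state -/

/-- The point `exp(2πit)` of the unit circle. -/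
noncomputable def turn (t : ℝ) : ℂ := Complex.exp ((2 * Real.pi * t : ℝ) * Complex.I)

theorem turn_add (s t : ℝ) : turn (s + t) = turn s * turn t := by
  rw [turn, turn, turn, ← Complex.exp_add]
  congr 1
  push_cast
  ring

theorem star_turn (t : ℝ) : star (turn t) = turn (-t) := by
  rw [turn, turn, Complex.star_def, ← Complex.exp_conj, map_mul, Complex.conj_I,
    Complex.conj_ofReal]
  congr 1
  push_cast
  ring

theorem turn_intCast (n : ℤ) : turn n = 1 := by
  rw [turn, Complex.exp_eq_one_iff]
  exact ⟨n, by push_cast; ring⟩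

theorem turn_natCast_mul (n : ℕ) (t : ℝ) : turn (n * t) = turn t ^ n := by
  rw [turn, turn, ← Complex.exp_nat_mul]
  congr 1
  push_cast
  ring

theorem turn_eq_one_iff {t : ℝ} : turn t = 1 ↔ ∃ n : ℤ, t = n := by
  constructor
  · intro h
    obtain ⟨n, hn⟩ := Complex.exp_eq_one_iff.1 h
    refine ⟨n, ?_⟩
    have h1 : ((2 * Real.pi * t : ℝ) : ℂ) = ((2 * Real.pi * n : ℝ) : ℂ) := by
      apply mul_right_cancel₀ Complex.I_ne_zero
      rw [hn]
      push_cast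
      ring
    have h2 := Complex.ofReal_injective h1
    exact mul_left_cancel₀ (by positivity) h2
  · rintro ⟨n, rfl⟩
    exact turn_intCast n

/-- The sum `∑_{l<q} exp(2πilt/q)` from which the amplitudes of Fourier measurements are built. -/
noncomputable def turnSum (q : ℕ) (t : ℝ) : ℂ := ∑ l ∈ Finset.range q, turn (l * (t / q))

theorem turnSum_add_mul {q : ℕ} (hq : 0 < q) (t : ℝ) (n : ℤ) :
    turnSum q (t + q * n) = turnSum q t := by
  refine Finset.sum_congr rfl fun l _ => ?_
  have : (l : ℝ) * ((t + q * n) / q) = l * (t / q) + ((l * n : ℤ) : ℝ) := by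
    push_cast
    field_simp
  rw [this, turn_add, turn_intCast, mul_one]

theorem turnSum_intCast {q : ℕ} {n : ℤ} (h0 : n ≠ 0) (hn : |n| < q) : turnSum q n = 0 := by
  have hq : (0 : ℤ) < q := (abs_nonneg n).trans_lt hn
  have hq' : (q : ℝ) ≠ 0 := by exact_mod_cast hq.ne'
  simp only [turnSum, turn_natCast_mul]
  have hne : turn (n / q) ≠ 1 := by
    rw [Ne, turn_eq_one_iff]
    rintro ⟨m, hm⟩
    rw [div_eq_iff hq'] at hm
    have hm' : n = m * q := by exact_mod_cast hm
    exact h0 (Int.eq_zero_of_abs_lt_dvd ⟨m, by rw [hm']; ring⟩ hn)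
  have h := mul_geom_sum (turn (n / q)) q
  rw [← turn_natCast_mul, mul_div_cancel₀ _ hq', turn_intCast, sub_self] at h
  exact (mul_eq_zero.1 h).resolve_left (sub_ne_zero.2 hne)

theorem turnSum_zero (q : ℕ) : turnSum q 0 = q := by
  have : turn 0 = 1 := by simpa using turn_intCast 0
  simp [turnSum, this]

/-- For small `t` the terms of the sum nearly align, since `cos x ≥ 1 - x² / 2`. -/
theorem le_normSq_turnSum (q : ℕ) (t : ℝ) :
    (q : ℝ) ^ 2 * (1 - (2 * Real.pi * t) ^ 2) ≤ ‖turnSum q t‖ ^ 2 := by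
  have hre : (q : ℝ) * (1 - (2 * Real.pi * t) ^ 2 / 2) ≤ ‖turnSum q t‖ := by
    refine le_trans ?_ (Complex.re_le_norm _)
    rw [turnSum, Complex.re_sum]
    have : ∀ l ∈ Finset.range q, 1 - (2 * Real.pi * t) ^ 2 / 2 ≤ (turn (l * (t / q))).re := by
      intro l hl
      have hl := Finset.mem_range.1 hl
      have hq : (0 : ℝ) < q := by exact_mod_cast (Nat.zero_le l).trans_lt hl
      rw [turn, Complex.exp_ofReal_mul_I_re]
      refine le_trans ?_ Real.one_sub_sq_div_two_le_cos
      have h1 : (2 * Real.pi * (l * (t / q))) = (l / q) * (2 * Real.pi * t) := by ring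
      have h2 : ((l : ℝ) / q) ^ 2 ≤ 1 := by
        rw [sq_le_one_iff₀ (by positivity), div_le_one hq]
        exact_mod_cast hl.le
      rw [h1, mul_pow]
      have := mul_le_mul_of_nonneg_right h2 (sq_nonneg (2 * Real.pi * t))
      linarith
    calc (q : ℝ) * (1 - (2 * Real.pi * t) ^ 2 / 2)
        = ∑ _l ∈ Finset.range q, (1 - (2 * Real.pi * t) ^ 2 / 2) := by
          rw [Finset.sum_const, Finset.card_range, nsmul_eq_mul]
      _ ≤ _ := Finset.sum_le_sum this
  generalize (2 * Real.pi * t) ^ 2 = y at hre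
  rcases le_or_gt y 1 with hy | hy
  · have h0 : 0 ≤ (q : ℝ) * (1 - y / 2) := mul_nonneg (Nat.cast_nonneg q) (by linarith)
    refine le_trans ?_ (pow_le_pow_left₀ h0 hre 2)
    rw [mul_pow]
    exact mul_le_mul_of_nonneg_left (by nlinarith [sq_nonneg y]) (sq_nonneg _)
  · exact le_trans (mul_nonpos_of_nonneg_of_nonpos (sq_nonneg _) (by linarith)) (sq_nonneg _)

theorem sum_val_lt {M : Type*} [AddCommMonoid M] [NeZero d] {q : ℕ} (hqd : q ≤ d) (f : ℕ → M) :
    ∑ l : ZMod d, (if l.val < q then f l.val else 0) = ∑ l ∈ Finset.range q, f l := by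
  rw [← Finset.sum_filter]
  refine Finset.sum_nbij' (fun l => l.val) (fun l => (l : ZMod d)) ?_ ?_ ?_ ?_ fun _ _ => rfl
  · intro l hl
    simpa using hl
  · intro l hl
    have hl := Finset.mem_range.1 hl
    simp [ZMod.val_natCast_of_lt (hl.trans_le hqd), hl]
  · intro l _
    simp
  · intro l hl
    exact ZMod.val_natCast_of_lt ((Finset.mem_range.1 hl).trans_le hqd)

/-- The unitary matrix whose row `a < q` is the Fourier vector
`q^{-1/2} (exp(2πil(a + θ)/q))_{l<q}` shifted by the angle `θ`, and whose rows `a ≥ q` are standard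
basis vectors. Its rows define a measurement of `ℂ^d`. -/
noncomputable def fourierMatrix (d q : ℕ) (θ : ℝ) : Matrix (ZMod d) (ZMod d) ℂ :=
  Matrix.of fun a l =>
    if a.val < q then
      if l.val < q then (Real.sqrt q : ℂ)⁻¹ * turn (l.val * ((a.val + θ) / q)) else 0
    else if a = l then 1 else 0

theorem sum_fourierMatrix_mul_star [NeZero d] {q : ℕ} (hqd : q ≤ d) (θ η : ℝ) {a b : ZMod d}
    (ha : a.val < q) (hb : b.val < q) :
    ∑ l, fourierMatrix d q θ a l * star (fourierMatrix d q η b l) =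
      (q : ℂ)⁻¹ * turnSum q (a.val - b.val + θ - η) := by
  rw [turnSum, Finset.mul_sum, ← sum_val_lt hqd]
  refine Finset.sum_congr rfl fun l _ => ?_
  simp only [fourierMatrix, Matrix.of_apply, ha, hb, if_true]
  by_cases hl : l.val < q
  · simp only [hl, if_true]
    have h1 : star ((Real.sqrt q : ℂ)⁻¹) = (Real.sqrt q : ℂ)⁻¹ := by
      rw [Complex.star_def, map_inv₀, Complex.conj_ofReal]
    have h2 : (Real.sqrt q : ℂ)⁻¹ * (Real.sqrt q : ℂ)⁻¹ = (q : ℂ)⁻¹ := by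
      rw [← mul_inv, ← Complex.ofReal_mul, Real.mul_self_sqrt (Nat.cast_nonneg q),
        Complex.ofReal_natCast]
    have h3 : turn (l.val * ((a.val - b.val + θ - η) / q)) =
        turn (l.val * ((a.val + θ) / q)) * turn (-(l.val * ((b.val + η) / q))) := by
      rw [← turn_add]
      congr 1
      ring
    rw [star_mul, star_turn, h1, h3, ← h2]
    ring
  · simp [hl]

theorem fourierMatrix_mem_unitaryGroup [NeZero d] {q : ℕ} (hqd : q ≤ d) (θ : ℝ) :
    fourierMatrix d q θ ∈ Matrix.unitaryGroup (ZMod d) ℂ := by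
  rw [Matrix.mem_unitaryGroup_iff]
  ext a b
  simp only [Matrix.mul_apply, Matrix.star_apply]
  by_cases ha : a.val < q
  · by_cases hb : b.val < q
    · rw [sum_fourierMatrix_mul_star hqd θ θ ha hb]
      have hq : (q : ℂ) ≠ 0 := by
        have : 0 < q := (Nat.zero_le _).trans_lt ha
        exact_mod_cast this.ne'
      by_cases hab : a = b
      · subst hab
        rw [show (a.val : ℝ) - a.val + θ - θ = 0 by ring, turnSum_zero, inv_mul_cancel₀ hq,
          Matrix.one_apply_eq]
      · have h0 : (a.val : ℤ) - b.val ≠ 0 := fun h =>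
          hab (ZMod.val_injective d (by omega))
        have h1 := turnSum_intCast (q := q) h0 (by rw [abs_lt]; omega)
        push_cast at h1
        rw [show (a.val : ℝ) - b.val + θ - θ = a.val - b.val by ring, h1, mul_zero,
          Matrix.one_apply_ne hab]
    · have hab : a ≠ b := fun h => hb (h ▸ ha)
      simp [fourierMatrix, ha, hb, hab]
  · by_cases hb : b.val < q
    · have hab : a ≠ b := fun h => ha (h ▸ hb)
      simp [fourierMatrix, ha, hb, hab]
    · simp [fourierMatrix, ha, hb, Matrix.one_apply]

theorem map_star_mem_unitaryGroup {n : Type*} [Fintype n] [DecidableEq n] {U : Matrix n n ℂ}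
    (hU : U ∈ Matrix.unitaryGroup n ℂ) : U.map star ∈ Matrix.unitaryGroup n ℂ := by
  rw [Matrix.mem_unitaryGroup_iff] at hU ⊢
  ext a b
  have h := congrArg star (congrFun (congrFun hU a) b)
  simp only [Matrix.mul_apply, Matrix.star_apply, star_sum, star_mul, star_star,
    Matrix.map_apply] at h ⊢
  simp only [mul_comm] at h ⊢
  rw [h, Matrix.one_apply]
  split_ifs <;> simp

theorem sum_normSq_mulVec_of_unitary {n : Type*} [Fintype n] [DecidableEq n] {U : Matrix n n ℂ}
    (hU : U ∈ Matrix.unitaryGroup n ℂ) (φ : EuclideanSpace ℂ n) :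
    ∑ x, ‖Matrix.toEuclideanLin U φ x‖ ^ 2 = ‖φ‖ ^ 2 := by
  have h : ∀ v : n → ℂ, ((∑ x, ‖v x‖ ^ 2 : ℝ) : ℂ) = star v ⬝ᵥ v := by
    intro v
    push_cast
    simp only [dotProduct, Pi.star_apply]
    refine Finset.sum_congr rfl fun x _ => ?_
    rw [Complex.star_def, mul_comm, Complex.mul_conj, Complex.normSq_eq_norm_sq]
    push_cast
    rfl
  rw [EuclideanSpace.norm_sq_eq]
  apply Complex.ofReal_injective
  rw [h, h, Matrix.toEuclideanLin, Matrix.toLpLin_apply]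
  rw [Matrix.star_mulVec, Matrix.dotProduct_mulVec, Matrix.vecMul_vecMul,
    ← Matrix.star_eq_conjTranspose, Matrix.mem_unitaryGroup_iff'.1 hU, Matrix.vecMul_one]

theorem norm_maxEntangled [NeZero d] {q : ℕ} (hq : 0 < q) (hqd : q ≤ d) :
    ‖maxEntangled d q‖ = 1 := by
  rw [EuclideanSpace.norm_eq, Real.sqrt_eq_one, Fintype.sum_prod_type]
  have h1 : ∀ k : ZMod d, ∑ l, ‖maxEntangled d q (k, l)‖ ^ 2 =
      if k.val < q then (q : ℝ)⁻¹ else 0 := by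
    intro k
    rw [Finset.sum_eq_single k]
    · by_cases hk : k.val < q
      · simp [maxEntangled, hk]
      · simp [maxEntangled, hk]
    · intro l _ hl
      simp [maxEntangled, hl.symm]
    · simp
  have hq' : (q : ℝ) ≠ 0 := by exact_mod_cast hq.ne'
  rw [Finset.sum_congr rfl fun k _ => h1 k, sum_val_lt hqd fun _ => (q : ℝ)⁻¹]
  simp [hq']

theorem kronecker_fourierMatrix_maxEntangled [NeZero d] {q : ℕ} (hqd : q ≤ d) (θ η : ℝ)
    {a b : ZMod d} (ha : a.val < q) (hb : b.val < q) :
    Matrix.toEuclideanLin (fourierMatrix d q θ ⊗ₖ (fourierMatrix d q η).map star)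
      (maxEntangled d q) (a, b) =
      (Real.sqrt q : ℂ)⁻¹ * ((q : ℂ)⁻¹ * turnSum q (a.val - b.val + θ - η)) := by
  rw [← sum_fourierMatrix_mul_star hqd θ η ha hb, Finset.mul_sum]
  rw [Matrix.toEuclideanLin, Matrix.toLpLin_apply]
  simp only [Matrix.mulVec, dotProduct, Fintype.sum_prod_type, Matrix.kroneckerMap_apply,
    Matrix.map_apply]
  refine Finset.sum_congr rfl fun l _ => ?_
  rw [Finset.sum_eq_single l]
  · by_cases hl : l.val < q
    · simp only [maxEntangled, hl, and_self, if_true]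
      ring
    · simp [maxEntangled, hl, fourierMatrix, ha]
  · intro m _ hm
    simp [maxEntangled, hm.symm]
  · simp

/-- The joint outcomes of the Fourier measurements with angles `θ` and `η` agree, up to a cyclic
shift by `s`, except with probability quadratic in `s + θ - η`. -/
theorem mismatch_fourier_le [NeZero d] {q : ℕ} (hq : 0 < q) (hqd : q ≤ d) (θ η : ℝ) (s : ℤ)
    {σ : ZMod d → ZMod d} (hσq : ∀ b : ZMod d, b.val < q → (σ b).val < q)
    (hσ : ∀ b : ZMod d, b.val < q → ∃ n : ℤ, ((σ b).val : ℤ) - b.val = s + q * n) :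
    mismatch σ (fun a b =>
      ‖Matrix.toEuclideanLin (fourierMatrix d q θ ⊗ₖ (fourierMatrix d q η).map star)
        (maxEntangled d q) (a, b)‖ ^ 2) ≤ (2 * Real.pi * (s + θ - η)) ^ 2 := by
  set p : ZMod d → ZMod d → ℝ := fun a b =>
      ‖Matrix.toEuclideanLin (fourierMatrix d q θ ⊗ₖ (fourierMatrix d q η).map star)
        (maxEntangled d q) (a, b)‖ ^ 2 with hp
  have hU := map_star_mem_unitaryGroup (fourierMatrix_mem_unitaryGroup (d := d) hqd η)
  have htot : ∑ a, ∑ b, p a b = 1 := by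
    have := sum_normSq_mulVec_of_unitary
      (Matrix.kronecker_mem_unitary (fourierMatrix_mem_unitaryGroup (d := d) hqd θ) hU)
      (maxEntangled d q)
    rw [norm_maxEntangled hq hqd, Fintype.sum_prod_type, one_pow] at this
    exact this
  have hmis : mismatch σ p = 1 - ∑ b, p (σ b) b := by
    rw [← htot, mismatch, Finset.sum_comm, Finset.sum_comm (f := fun a b => p a b),
      ← Finset.sum_sub_distrib]
    refine Finset.sum_congr rfl fun b _ => ?_
    rw [← Finset.add_sum_erase _ _ (Finset.mem_univ (σ b)),
      ← Finset.add_sum_erase _ (fun a => p a b) (Finset.mem_univ (σ b)), if_pos rfl, zero_add,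
      add_sub_cancel_left]
    exact Finset.sum_congr rfl fun a ha => if_neg (Finset.ne_of_mem_erase ha)
  have hq' : (0 : ℝ) < q := by exact_mod_cast hq
  have hdiag : ∀ b : ZMod d, (if b.val < q then
      (q : ℝ)⁻¹ * (1 - (2 * Real.pi * (s + θ - η)) ^ 2) else 0) ≤ p (σ b) b := by
    intro b
    split_ifs with hb
    · obtain ⟨n, hn⟩ := hσ b hb
      simp only [hp]
      have hn' : ((σ b).val : ℝ) - b.val = s + q * n := by exact_mod_cast hn
      rw [kronecker_fourierMatrix_maxEntangled hqd θ η (hσq b hb) hb, hn',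
        show (s : ℝ) + q * n + θ - η = (s + θ - η) + q * n by ring, turnSum_add_mul hq,
        norm_mul, norm_mul, norm_inv, norm_inv, Complex.norm_real, Complex.norm_natCast,
        Real.norm_of_nonneg (Real.sqrt_nonneg _), mul_pow (Real.sqrt q)⁻¹, mul_pow (q : ℝ)⁻¹,
        inv_pow, inv_pow, Real.sq_sqrt hq'.le]
      refine mul_le_mul_of_nonneg_left ?_ (inv_nonneg.2 hq'.le)
      have := le_normSq_turnSum q (s + θ - η)
      rw [inv_mul_eq_div, le_div_iff₀ (by positivity), mul_comm]
      exact this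
    · exact sq_nonneg _
  have hsum : ∑ b : ZMod d, (if b.val < q then
      (q : ℝ)⁻¹ * (1 - (2 * Real.pi * (s + θ - η)) ^ 2) else 0) =
      1 - (2 * Real.pi * (s + θ - η)) ^ 2 := by
    rw [sum_val_lt hqd fun _ => (q : ℝ)⁻¹ * (1 - (2 * Real.pi * (s + θ - η)) ^ 2),
      Finset.sum_const, Finset.card_range, nsmul_eq_mul, ← mul_assoc, mul_inv_cancel₀ hq'.ne',
      one_mul]
  have := Finset.sum_le_sum fun b (_ : b ∈ Finset.univ) => hdiag b
  rw [hmis]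
  linarith

/-- The cyclic shift `0 → 1 → ⋯ → q - 1 → 0` of the residues below `q`; the others are sent to
`0`. -/
def cyclicShift (d q : ℕ) (b : ZMod d) : ZMod d :=
  if b.val + 1 < q then ((b.val + 1 : ℕ) : ZMod d) else 0

theorem cyclicShift_val [NeZero d] {q : ℕ} (hqd : q ≤ d) (b : ZMod d) :
    (cyclicShift d q b).val = if b.val + 1 < q then b.val + 1 else 0 := by
  unfold cyclicShift
  split_ifs with h
  · exact ZMod.val_natCast_of_lt (h.trans_le hqd)
  · exact ZMod.val_zero

theorem cyclicShift_ne [NeZero d] {q : ℕ} (hq : 2 ≤ q) (hqd : q ≤ d) (b : ZMod d) :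
    cyclicShift d q b ≠ b := by
  intro h
  have := congrArg ZMod.val h
  rw [cyclicShift_val hqd] at this
  split_ifs at this <;> omega

/-- On a maximally entangled state, Fourier measurements whose angles advance in `2(n + 1)` equal
steps make the chained expression of order `1 / n`: every step contributes the square of its
size, and the ends of the chain are one step short of a full cyclic shift. -/
theorem exists_chainSum_le [NeZero d] {q : ℕ} (hq : 2 ≤ q) (hqd : q ≤ d) {φ : PairSpace d}
    (hφ : IsMaximallyEntangled q φ) (n : ℕ) :
    ∃ A B : ℕ → Matrix.unitaryGroup (ZMod d) ℂ, (Set.range A).Finite ∧ (Set.range B).Finite ∧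
      (chainSum (cyclicShift d q) n fun k l a b =>
        ‖Matrix.toEuclideanLin ((A k : Matrix (ZMod d) (ZMod d) ℂ) ⊗ₖ B l) φ (a, b)‖ ^ 2) ≤
      2 * Real.pi ^ 2 / (n + 1) := by
  obtain ⟨U, hU, V, hV, hUV⟩ := hφ
  have hq0 : 0 < q := by omega
  set θ : ℕ → ℝ := fun k => k / (n + 1) with hθ
  set η : ℕ → ℝ := fun k => (k + 1 / 2) / (n + 1) with hη
  set A : ℕ → Matrix.unitaryGroup (ZMod d) ℂ := fun k =>
    ⟨_, fourierMatrix_mem_unitaryGroup (d := d) hqd (θ k)⟩ * ⟨U, hU⟩ with hA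
  set B : ℕ → Matrix.unitaryGroup (ZMod d) ℂ := fun k =>
    ⟨_, map_star_mem_unitaryGroup (fourierMatrix_mem_unitaryGroup (d := d) hqd (η k))⟩ *
      ⟨V, hV⟩ with hB
  -- Only the indices up to `n` matter; capping them leaves finitely many measurements.
  set p : ℕ → ℕ → ZMod d → ZMod d → ℝ := fun k l a b =>
    ‖Matrix.toEuclideanLin ((A (min k n) : Matrix (ZMod d) (ZMod d) ℂ) ⊗ₖ B (min l n)) φ
      (a, b)‖ ^ 2 with hp
  have hfin : ∀ f : ℕ → Matrix.unitaryGroup (ZMod d) ℂ,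
      (Set.range fun k => f (min k n)).Finite := fun f =>
    ((Set.finite_Iic n).image f).subset (by
      rintro _ ⟨k, rfl⟩
      exact ⟨min k n, Set.mem_Iic.2 (min_le_right _ _), rfl⟩)
  have hAB : ∀ k ≤ n, ∀ l ≤ n, p k l = fun a b =>
      ‖Matrix.toEuclideanLin (fourierMatrix d q (θ k) ⊗ₖ (fourierMatrix d q (η l)).map star)
        (maxEntangled d q) (a, b)‖ ^ 2 := by
    intro k hk l hl
    have h1 : ((A k : Matrix (ZMod d) (ZMod d) ℂ) ⊗ₖ (B l : Matrix (ZMod d) (ZMod d) ℂ)) =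
        (fourierMatrix d q (θ k) ⊗ₖ (fourierMatrix d q (η l)).map star) * (U ⊗ₖ V) := by
      rw [← Matrix.mul_kronecker_mul]
      rfl
    simp only [hp, min_eq_left hk, min_eq_left hl]
    rw [h1, ← hUV]
    simp only [Matrix.toEuclideanLin]
    rw [Matrix.toLpLin_mul_same]
    rfl
  have hn : (0 : ℝ) < n + 1 := by positivity
  have hid : ∀ k ≤ n, ∀ l ≤ n, mismatch id (p k l) ≤
      (2 * Real.pi * (θ k - η l)) ^ 2 := by
    intro k hk l hl
    rw [hAB k hk l hl]
    have := mismatch_fourier_le (d := d) hq0 hqd (θ k) (η l) 0 (σ := id) (fun b hb => hb)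
      (fun b _ => ⟨0, by simp⟩)
    simpa using this
  have h1 : ∀ k ∈ Finset.range (n + 1), mismatch id (p k k) ≤
      (Real.pi / (n + 1)) ^ 2 := by
    intro k hk
    have hk := Finset.mem_range.1 hk
    refine (hid k (by omega) k (by omega)).trans (le_of_eq ?_)
    simp only [hθ, hη]
    field_simp
    ring
  have h2 : ∀ k ∈ Finset.range n, mismatch id (p (k + 1) k) ≤
      (Real.pi / (n + 1)) ^ 2 := by
    intro k hk
    have hk := Finset.mem_range.1 hk
    refine (hid (k + 1) (by omega) k (by omega)).trans (le_of_eq ?_)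
    simp only [hθ, hη]
    push_cast
    field_simp
    ring
  have h3 : mismatch (cyclicShift d q) (p 0 n) ≤
      (Real.pi / (n + 1)) ^ 2 := by
    rw [hAB 0 (Nat.zero_le n) n le_rfl]
    refine (mismatch_fourier_le (d := d) hq0 hqd (θ 0) (η n) 1 (fun b hb => ?_)
      fun b hb => ?_).trans (le_of_eq ?_)
    · rw [cyclicShift_val hqd]
      split_ifs <;> omega
    · rw [cyclicShift_val hqd]
      split_ifs with h
      · exact ⟨0, by push_cast; ring⟩
      · exact ⟨-1, by omega⟩
    · simp only [hθ, hη]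
      push_cast
      field_simp
      ring
  refine ⟨fun k => A (min k n), fun k => B (min k n), hfin A, hfin B, ?_⟩
  change chainSum (cyclicShift d q) n p ≤ _
  refine (add_le_add (add_le_add (Finset.sum_le_sum h1) (Finset.sum_le_sum h2)) h3).trans
    (le_of_eq ?_)
  simp only [Finset.sum_const, Finset.card_range, nsmul_eq_mul]
  push_cast
  field_simp
  ring

/-! ### Behaviors of projective measurements -/

/-- The projective measurement of the orthonormal basis given by the conjugated rows of a unitary
matrix `W`, with outcomes labelled by `e`. -/
def projective {D K : Type*} [Fintype D] [DecidableEq D] [Fintype K] (e : K ≃ D)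
    (W : Matrix.unitaryGroup D ℂ) : Measurement D K where
  effect k := Matrix.vecMulVec (star ((W : Matrix D D ℂ) (e k))) ((W : Matrix D D ℂ) (e k))
  posSemidef k := Matrix.posSemidef_vecMulVec_star_self _
  sum_eq_one := by
    rw [e.sum_comp fun k => Matrix.vecMulVec (star ((W : Matrix D D ℂ) k)) ((W : Matrix D D ℂ) k)]
    have h := Matrix.mem_unitaryGroup_iff'.1 W.2
    rw [← h]
    ext x y
    simp [Matrix.sum_apply, Matrix.vecMulVec_apply, Matrix.mul_apply]

theorem tensorOp_mul [NeZero d] (A B : Fin N → Matrix (ZMod d) (ZMod d) ℂ) :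
    tensorOp A * tensorOp B = tensorOp fun l => A l * B l := by
  ext x z
  simp only [tensorOp, Matrix.mul_apply, Matrix.of_apply, Finset.prod_univ_sum,
    Fintype.piFinset_univ, Finset.prod_mul_distrib]

theorem tensorOp_one [NeZero d] :
    tensorOp (fun _ : Fin N => (1 : Matrix (ZMod d) (ZMod d) ℂ)) = 1 := by
  ext x y
  simp only [tensorOp, Matrix.of_apply, Matrix.one_apply]
  by_cases h : x = y
  · simp [h]
  · obtain ⟨l, hl⟩ := Function.ne_iff.1 h
    rw [if_neg h]
    exact Finset.prod_eq_zero (Finset.mem_univ l) (if_neg hl)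

theorem tensorOp_mem_unitaryGroup [NeZero d] (W : Fin N → Matrix.unitaryGroup (ZMod d) ℂ) :
    tensorOp (fun l => (W l : Matrix (ZMod d) (ZMod d) ℂ)) ∈
      Matrix.unitaryGroup (Fin N → ZMod d) ℂ := by
  rw [Matrix.mem_unitaryGroup_iff]
  have : star (tensorOp fun l => (W l : Matrix (ZMod d) (ZMod d) ℂ)) =
      tensorOp fun l => star (W l : Matrix (ZMod d) (ZMod d) ℂ) := by
    ext x y
    simp [tensorOp, Matrix.star_apply]
  rw [this, tensorOp_mul]
  simp only [Matrix.mem_unitaryGroup_iff.1 (W _).2]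
  exact tensorOp_one

/-- The Born rule for projective measurements of a pure state. -/
theorem bornBehavior_projective [NeZero d] {X K : Type*} [Fintype K] (e : K ≃ ZMod d)
    (ψ : Space N d) (W : X → Matrix.unitaryGroup (ZMod d) ℂ) (x : Fin N → X) (a : Fin N → K) :
    bornBehavior (pureDensity ψ) (fun _ s => projective e (W s)) x a =
      ‖Matrix.toEuclideanLin (tensorOp fun l => (W (x l) : Matrix (ZMod d) (ZMod d) ℂ)) ψ
        (fun l => e (a l))‖ ^ 2 := by
  have hent : ∀ y z, tensorOp (fun i => (projective e (W (x i))).effect (a i)) y z =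
      star (tensorOp (fun l => (W (x l) : Matrix (ZMod d) (ZMod d) ℂ)) (fun l => e (a l)) y) *
        tensorOp (fun l => (W (x l) : Matrix (ZMod d) (ZMod d) ℂ)) (fun l => e (a l)) z := by
    intro y z
    simp only [tensorOp, projective, Matrix.of_apply, Matrix.vecMulVec_apply, Pi.star_apply,
      Finset.prod_mul_distrib, star_prod]
  set T := tensorOp (fun l => (W (x l) : Matrix (ZMod d) (ZMod d) ℂ)) (fun l => e (a l)) with hT
  have hv : Matrix.toEuclideanLin (tensorOp fun l => (W (x l) : Matrix (ZMod d) (ZMod d) ℂ)) ψ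
      (fun l => e (a l)) = ∑ z, T z * ψ z := by
    rw [Matrix.toEuclideanLin, Matrix.toLpLin_apply]
    rfl
  rw [hv, bornBehavior]
  have : Matrix.trace (tensorOp (fun i => (projective e (W (x i))).effect (a i)) *
      pureDensity ψ) = (∑ z, T z * ψ z) * star (∑ z, T z * ψ z) := by
    simp only [Matrix.trace, Matrix.diag, Matrix.mul_apply, hent, pureDensity, Matrix.of_apply,
      star_sum, Finset.sum_mul_sum]
    rw [Finset.sum_comm]
    refine Finset.sum_congr rfl fun z _ => Finset.sum_congr rfl fun y _ => ?_
    rw [star_mul]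
    ring
  rw [this, Complex.star_def, Complex.mul_conj, Complex.ofReal_re, Complex.normSq_eq_norm_sq]

theorem isBehavior_bornBehavior_projective [NeZero d] {X K : Type*} [Fintype K] (e : K ≃ ZMod d)
    {ψ : Space N d} (hψ : ‖ψ‖ = 1) (W : X → Matrix.unitaryGroup (ZMod d) ℂ) :
    IsBehavior (bornBehavior (pureDensity ψ) fun _ s => projective e (W s)) := by
  refine ⟨fun x a => ?_, fun x => ?_⟩
  · rw [bornBehavior_projective]
    exact sq_nonneg _
  · simp only [bornBehavior_projective]
    refine ((Equiv.piCongrRight fun _ : Fin N => e).sum_comp fun y => ‖Matrix.toEuclideanLin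
      (tensorOp fun l => (W (x l) : Matrix (ZMod d) (ZMod d) ℂ)) ψ y‖ ^ 2).trans ?_
    rw [sum_normSq_mulVec_of_unitary (tensorOp_mem_unitaryGroup fun l => W (x l)), hψ, one_pow]

theorem mismatch_comp_equiv {K L : Type*} [Fintype K] [DecidableEq K] [Fintype L] [DecidableEq L]
    (e : K ≃ L) (σ : L → L) (p : L → L → ℝ) :
    mismatch (fun k => e.symm (σ (e k))) (fun α β => p (e α) (e β)) = mismatch σ p := by
  simp only [mismatch, Equiv.eq_symm_apply]
  rw [← e.sum_comp]
  refine Finset.sum_congr rfl fun α _ => ?_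
  rw [← e.sum_comp]

theorem chainSum_comp_equiv {K L : Type*} [Fintype K] [DecidableEq K] [Fintype L] [DecidableEq L]
    (e : K ≃ L) (σ : L → L) (n : ℕ) (p : ℕ → ℕ → L → L → ℝ) :
    chainSum (fun k => e.symm (σ (e k))) n (fun k l α β => p k l (e α) (e β)) =
      chainSum σ n p := by
  have hid := fun k l => mismatch_comp_equiv e id (p k l)
  simp only [id, Equiv.symm_apply_apply] at hid
  simp only [chainSum, mismatch_comp_equiv e σ]
  simp only [← hid]
  rfl

/-- If all parties but `i`, `j` measure in the computational basis, the amplitudes of the outcomes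
are those of the pair state conditioned on the other outcomes. -/
theorem tensorOp_apply_eq_condVec [NeZero d] (ψ : Space N d) {i j : Fin N} (hij : i ≠ j)
    (A B : Matrix (ZMod d) (ZMod d) ℂ) {W : Fin N → Matrix (ZMod d) (ZMod d) ℂ}
    (hWi : W i = A) (hWj : W j = B) (hW : ∀ l, l ≠ i → l ≠ j → W l = 1) (a : Fin N → ZMod d)
    (α β : ZMod d) :
    Matrix.toEuclideanLin (tensorOp W) ψ (Function.update (Function.update a i α) j β) =
      Matrix.toEuclideanLin (A ⊗ₖ B) (condVec ψ i j a) (α, β) := by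
  subst hWi hWj
  rw [Matrix.toEuclideanLin, Matrix.toLpLin_apply, Matrix.toEuclideanLin, Matrix.toLpLin_apply]
  simp only [Matrix.mulVec, dotProduct]
  symm
  refine Finset.sum_of_injOn (fun p => Function.update (Function.update a i p.1) j p.2) ?_
    (fun _ _ => Finset.mem_coe.2 (Finset.mem_univ _)) ?_ ?_
  · rintro ⟨s, t⟩ - ⟨s', t'⟩ - h
    have h1 := congrFun h i
    have h2 := congrFun h j
    simp only [Function.update_self, Function.update_of_ne hij] at h1 h2
    rw [h1, h2]
  · intro y _ hy
    have : ∃ l, l ≠ i ∧ l ≠ j ∧ a l ≠ y l := by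
      by_contra! hc
      refine hy ⟨(y i, y j), by simp, ?_⟩
      ext l
      by_cases hlj : l = j
      · subst hlj; simp
      · by_cases hli : l = i
        · subst hli; simp [hlj]
        · simp [hlj, hli, hc l hli hlj]
    obtain ⟨l, hli, hlj, hl⟩ := this
    have : tensorOp W (Function.update (Function.update a i α) j β) y = 0 :=
      Finset.prod_eq_zero (Finset.mem_univ l) (by simp [hW l hli hlj, hli, hlj, hl])
    rw [this, zero_mul]
  · rintro ⟨s, t⟩ -
    simp only [condVec, tensorOp, Matrix.of_apply, Matrix.kroneckerMap_apply]
    congr 1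
    rw [← Finset.mul_prod_erase _ _ (Finset.mem_univ i),
      ← Finset.mul_prod_erase _ _ (Finset.mem_erase.2 ⟨hij.symm, Finset.mem_univ j⟩),
      Finset.prod_eq_one]
    · simp [hij]
    · intro l hl
      have hlj := Finset.ne_of_mem_erase hl
      have hli := Finset.ne_of_mem_erase (Finset.mem_of_mem_erase hl)
      simp [hW l hli hlj, hli, hlj]

theorem norm_condVec_le [NeZero d] (ψ : Space N d) {i j : Fin N} (hij : i ≠ j)
    (a : Fin N → ZMod d) : ‖condVec ψ i j a‖ ≤ ‖ψ‖ := by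
  refine le_of_sq_le_sq ?_ (norm_nonneg _)
  rw [EuclideanSpace.norm_sq_eq, EuclideanSpace.norm_sq_eq]
  have hinj : Function.Injective fun p : ZMod d × ZMod d =>
      Function.update (Function.update a i p.1) j p.2 := by
    rintro ⟨s, t⟩ ⟨s', t'⟩ h
    have h1 := congrFun h i
    have h2 := congrFun h j
    simp only [Function.update_self, Function.update_of_ne hij] at h1 h2
    rw [h1, h2]
  calc ∑ p, ‖condVec ψ i j a p‖ ^ 2
      = ∑ x ∈ Finset.univ.map ⟨_, hinj⟩, ‖ψ x‖ ^ 2 := by rw [Finset.sum_map]; rfl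
    _ ≤ ∑ x, ‖ψ x‖ ^ 2 :=
      Finset.sum_le_sum_of_subset_of_nonneg (Finset.subset_univ _) fun _ _ _ => sq_nonneg _

/-! ### Full nonlocality of graph states -/

section FullyNonlocal

variable [NeZero d] {β : Type*} {G : Graph (Fin N) β} {ψ : Space N d}

/-- A set of local measurements (given by unitaries) that contains the computational basis and, for
each pair `i`, `j` joined in the reduced graph and all outcomes of the other parties, chained
measurements for the pair state that these outcomes leave. -/
def IsChainedSet (G : Graph (Fin N) β) (ψ : Space N d) (n : ℕ)
    (T : Set (Matrix.unitaryGroup (ZMod d) ℂ)) : Prop :=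
  1 ∈ T ∧ ∀ i j : Fin N, i ≠ j → ¬ d ∣ edgeMult G i j →
    ∃ σ : ZMod d → ZMod d, (∀ b, σ b ≠ b) ∧ ∀ a : Fin N → ZMod d,
    ∃ A B : ℕ → Matrix.unitaryGroup (ZMod d) ℂ, (∀ k, A k ∈ T) ∧ (∀ k, B k ∈ T) ∧
      (chainSum σ n fun k l a' b' => ‖Matrix.toEuclideanLin
        ((A k : Matrix (ZMod d) (ZMod d) ℂ) ⊗ₖ B l) (postState ψ i j a) (a', b')‖ ^ 2) ≤
      2 * Real.pi ^ 2 / (n + 1)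

theorem IsChainedSet.mono {n : ℕ} {T T' : Set (Matrix.unitaryGroup (ZMod d) ℂ)}
    (hT : IsChainedSet G ψ n T) (h : T ⊆ T') : IsChainedSet G ψ n T' := by
  refine ⟨h hT.1, fun i j hij hd => ?_⟩
  obtain ⟨σ, hσ, hch⟩ := hT.2 i j hij hd
  refine ⟨σ, hσ, fun a => ?_⟩
  obtain ⟨A, B, hA, hB, hAB⟩ := hch a
  exact ⟨A, B, fun k => h (hA k), fun k => h (hB k), hAB⟩

variable [G.Loopless]

theorem IsGraphState.exists_finite_isChainedSet (hψ : IsGraphState G ψ) (n : ℕ) :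
    ∃ T : Set (Matrix.unitaryGroup (ZMod d) ℂ), T.Finite ∧ IsChainedSet G ψ n T := by
  have key : ∀ (i j : Fin N) (a : Fin N → ZMod d),
      ∃ A B : ℕ → Matrix.unitaryGroup (ZMod d) ℂ, (Set.range A).Finite ∧ (Set.range B).Finite ∧
      (i ≠ j → ¬ d ∣ edgeMult G i j →
        (chainSum (cyclicShift d (d / Nat.gcd d (edgeMult G i j))) n fun k l a' b' =>
          ‖Matrix.toEuclideanLin ((A k : Matrix (ZMod d) (ZMod d) ℂ) ⊗ₖ B l) (postState ψ i j a)
            (a', b')‖ ^ 2) ≤ 2 * Real.pi ^ 2 / (n + 1)) := by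
    intro i j a
    by_cases h : i ≠ j ∧ ¬ d ∣ edgeMult G i j
    · obtain ⟨A, B, hA, hB, hAB⟩ := exists_chainSum_le (two_le_div_gcd h.2) (Nat.div_le_self _ _)
        (hψ.isMaximallyEntangled h.1 a) n
      exact ⟨A, B, hA, hB, fun _ _ => hAB⟩
    · exact ⟨fun _ => 1, fun _ => 1, Set.finite_range_const, Set.finite_range_const,
        fun h1 h2 => absurd ⟨h1, h2⟩ h⟩
  choose A B hA hB hAB using key
  refine ⟨{1} ∪ ⋃ i, ⋃ j, ⋃ a, (Set.range (A i j a) ∪ Set.range (B i j a)), ?_, ?_, ?_⟩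
  · exact (Set.finite_singleton _).union (Set.finite_iUnion fun i => Set.finite_iUnion fun j =>
      Set.finite_iUnion fun a => (hA i j a).union (hB i j a))
  · exact Or.inl rfl
  · intro i j hij hd
    refine ⟨_, cyclicShift_ne (two_le_div_gcd hd) (Nat.div_le_self _ _), fun a =>
      ⟨A i j a, B i j a, fun k => Or.inr ?_, fun k => Or.inr ?_, hAB i j a hij hd⟩⟩
    · simp only [Set.mem_iUnion]
      exact ⟨i, j, a, Or.inl ⟨k, rfl⟩⟩
    · simp only [Set.mem_iUnion]
      exact ⟨i, j, a, Or.inr ⟨k, rfl⟩⟩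

theorem IsGraphState.normSq_condVec_le (hψ : IsGraphState G ψ) {i j : Fin N} (hij : i ≠ j)
    (a : Fin N → ZMod d) (L : PairSpace d →ₗ[ℂ] PairSpace d) (p : ZMod d × ZMod d) :
    ‖L (condVec ψ i j a) p‖ ^ 2 ≤ ‖L (postState ψ i j a) p‖ ^ 2 := by
  have h0 : (‖condVec ψ i j a‖ : ℂ) ≠ 0 := by
    exact_mod_cast norm_ne_zero_iff.2 (hψ.condVec_ne_zero hij a)
  have h : condVec ψ i j a = (‖condVec ψ i j a‖ : ℂ) • postState ψ i j a := by
    rw [postState, smul_smul, Complex.ofReal_inv, mul_inv_cancel₀ h0, one_smul]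
  rw [h, map_smul, PiLp.smul_apply, norm_smul, Complex.norm_real, norm_norm, mul_pow]
  refine mul_le_of_le_one_left (sq_nonneg _) (pow_le_one₀ (norm_nonneg _) ?_)
  exact (norm_condVec_le ψ hij a).trans_eq hψ.1

theorem IsChainedSet.isChainedAcross {n : ℕ} {T : Set (Matrix.unitaryGroup (ZMod d) ℂ)}
    (hT : IsChainedSet G ψ n T) (hψ : IsGraphState G ψ) (hG : (reducedGraph d G).Connected)
    {X K : Type*} [Fintype K] [DecidableEq K] (e : K ≃ ZMod d)
    {W : X → Matrix.unitaryGroup (ZMod d) ℂ} (hW : Set.range W = T) {Q : Finset (Fin N)}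
    (hQ : Q ∈ bipartitions N) :
    IsChainedAcross (2 * Real.pi ^ 2 / (n + 1)) Q
      (bornBehavior (pureDensity ψ) fun _ s => projective e (W s)) := by
  obtain ⟨i, hi, j, hj, hd⟩ := exists_crossing_of_connected hG hQ
  have hij : i ≠ j := fun h => Finset.mem_compl.1 hj (h ▸ hi)
  subst hW
  obtain ⟨s₀, hs₀⟩ := hT.1
  obtain ⟨σ, hσ, hch⟩ := hT.2 i j hij hd
  refine ⟨i, hi, j, hj, fun k => e.symm (σ (e k)), fun b hb => hσ (e b) ?_, fun _ => s₀,
    fun a => ?_⟩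
  · rwa [Equiv.symm_apply_eq] at hb
  · obtain ⟨A, B, hA, hB, hAB⟩ := hch fun l => e (a l)
    choose sA hsA using hA
    choose sB hsB using hB
    refine ⟨sA, sB, n, le_trans ?_ hAB⟩
    rw [← chainSum_comp_equiv e σ n]
    refine chainSum_mono fun k l α b => ?_
    rw [bornBehavior_projective]
    have hupd : (fun m => e (Function.update (Function.update a i α) j b m)) =
        Function.update (Function.update (fun m => e (a m)) i (e α)) j (e b) := by
      ext m
      by_cases hmj : m = j
      · subst hmj; simp
      · by_cases hmi : m = i
        · subst hmi; simp [hmj]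
        · simp [hmj, hmi]
    rw [hupd, tensorOp_apply_eq_condVec ψ hij (A k) (B l)]
    · exact hψ.normSq_condVec_le hij _ _ _
    · simp [hij, hsA]
    · simp [hsB]
    · intro m hmi hmj
      simp [hmi, hmj, hs₀]

theorem exists_chain_bound_le (C : ℝ) (D : ℝ) {ε : ℝ} (hε : 0 < ε) :
    ∃ n : ℕ, C * (D * (2 * Real.pi ^ 2 / (n + 1))) ≤ ε := by
  obtain ⟨n, hn⟩ := exists_nat_gt (C * D * (2 * Real.pi ^ 2) / ε)
  refine ⟨n, ?_⟩
  have h1 : (0 : ℝ) < n + 1 := by positivity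
  have h2 : C * (D * (2 * Real.pi ^ 2 / (n + 1))) = C * D * (2 * Real.pi ^ 2) / (n + 1) := by ring
  rw [h2, div_le_iff₀ h1]
  rw [div_lt_iff₀ hε] at hn
  nlinarith

theorem IsGraphState.isFinitelyApproxMFNL (hψ : IsGraphState G ψ)
    (hG : (reducedGraph d G).Connected) : IsFinitelyApproxMFNL (pureDensity ψ) := by
  intro ε hε
  -- A content bound of at least `1 / 2` also certifies that the behavior has a decomposition.
  obtain ⟨n, hn⟩ := exists_chain_bound_le (bipartitions N).card (Fintype.card (Fin N → Fin d))
    (lt_min hε one_half_pos)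
  obtain ⟨T, hT, hch⟩ := hψ.exists_finite_isChainedSet n
  obtain ⟨m, W, -, hW⟩ := hT.fin_param
  set e : Fin d ≃ ZMod d := (ZMod.finEquiv d).toEquiv
  have : Nonempty (Fin d) := ⟨e.symm 0⟩
  refine ⟨m, d, fun _ s => projective e (W s), ?_⟩
  have h1 := min_le_left ε (1 / 2)
  have h2 := min_le_right ε (1 / 2)
  refine le_trans (by linarith : 1 - ε ≤ 1 - min ε (1 / 2))
    (le_nonlocalityContent (isBehavior_bornBehavior_projective e hψ.1 W) (by linarith)
      fun p hp => ?_)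
  have := hp.one_sub_le fun Q hQ => hch.isChainedAcross hψ hG e hW hQ
  linarith

theorem IsGraphState.isMFNL (hψ : IsGraphState G ψ) (hG : (reducedGraph d G).Connected) :
    IsMFNL (pureDensity ψ) := by
  choose T hT hch using hψ.exists_finite_isChainedSet
  obtain ⟨W, hW⟩ := (Set.countable_iUnion fun n => (hT n).countable).exists_eq_range
    ⟨1, Set.mem_iUnion.2 ⟨0, (hch 0).1⟩⟩
  set e : Fin d ≃ ZMod d := (ZMod.finEquiv d).toEquiv
  have : Nonempty (Fin d) := ⟨e.symm 0⟩
  refine ⟨d, fun _ s => projective e (W s), ?_⟩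
  have hbeh := isBehavior_bornBehavior_projective e hψ.1 W
  have hone : ∀ p, HasDecomposition (bornBehavior (pureDensity ψ)
      fun _ s => projective e (W s)) p → 1 ≤ p := by
    intro p hp
    refine le_of_forall_pos_le_add fun ε hε => ?_
    obtain ⟨n, hn⟩ := exists_chain_bound_le (bipartitions N).card
      (Fintype.card (Fin N → Fin d)) hε
    have := hp.one_sub_le fun Q hQ =>
      ((hch n).mono (Set.subset_iUnion T n)).isChainedAcross hψ hG e hW.symm hQ
    linarith
  exact le_antisymm (nonlocalityContent_le_one hbeh fun p hp => zero_lt_one.trans_le (hone p hp))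
    (le_nonlocalityContent hbeh zero_lt_one hone)

end FullyNonlocal

end QuditGraph

theorem mainTheorem4 {N d : ℕ} [NeZero N] [NeZero d] {β : Type*} (G : Graph (Fin N) β)
    [G.Loopless] (hV : G.vertexSet = Set.univ) (hE : G.edgeSet.Finite)
    (ψ : EuclideanSpace ℂ (Fin N → ZMod d)) (hψ : IsGraphState G ψ) :
    (IsGME ψ ↔ (reducedGraph d G).Connected) ∧
    (IsGME ψ → IsMFNL (pureDensity ψ) ∧ IsFinitelyApproxMFNL (pureDensity ψ)) ∧
    ∀ i j : Fin N, i ≠ j → ∀ a : Fin N → ZMod d,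
      condVec ψ i j a ≠ 0 ∧
      IsPairStabilized (edgeMult G i j) (outcomePhase G i j a) (outcomePhase G j i a)
        (postState ψ i j a) ∧
      (∀ φ : EuclideanSpace ℂ (ZMod d × ZMod d),
        IsPairStabilized (edgeMult G i j) (outcomePhase G i j a) (outcomePhase G j i a) φ →
          ∃ c : ℂ, φ = c • postState ψ i j a) ∧
      IsMaximallyEntangled (d / Nat.gcd d (edgeMult G i j)) (postState ψ i j a) ∧
      (¬ d ∣ edgeMult G i j → 2 ≤ d / Nat.gcd d (edgeMult G i j)) := by
  refine ⟨hψ.isGME_iff, fun h => ?_, fun i j hij a => ?_⟩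
  · have hG := hψ.isGME_iff.1 h
    exact ⟨hψ.isMFNL hG, hψ.isFinitelyApproxMFNL hG⟩
  · exact ⟨hψ.condVec_ne_zero hij a, hψ.isPairStabilized hij a,
      fun φ hφ => hψ.eq_smul_postState hij a hφ, hψ.isMaximallyEntangled hij a, two_le_div_gcd⟩
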